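/- Let $d\ge 1$, $1\le p<\infty$, and let $(\nu_\varepsilon)_{\varepsilon>0}$ be measurable radial functions $\nu_\varepsilon:\mathbb{R}^d\setminus\{0\}\to[0,\infty]$ such that, for every $\varepsilon>0$ and every $\delta>0$, $$\int_{\mathbb{R}^d}(1\wedge|h|^p)\,\nu_\varepsilon(h)\,dh=1\qquad\text{and}\qquad \lim_{\varepsilon\to0^+}\int_{|h|>\delta}(1\wedge|h|^p)\,\nu_\varepsilon(h)\,dh=0 .$$ Let $K_{d,p}$ be the mean value of $w\mapsto|w\cdot e|^p$ over the unit sphere $\mathbb{S}^{d-1}$ with respect to surface measure, where $e\in\mathbb{S}^{d-1}$ is any unit vector. Let $\Omega\subset\mathbb{R}^d$ be an arbitrary open set (not necessarily an extension domain). For $u:\Omega\to\mathbb{R}$ measurable put $$d\mu_\varepsilon(x)=\Big(\int_\Omega|u(x)-u(y)|^p\,\nu_\varepsilon(x-y)\,dy\Big)\,dx\quad\text{on }\Omega .$$ A Radon measure on $\Omega$ is a Borel measure on $\Omega$ that is finite on compact subsets of $\Omega$; Radon measures $\mu_\varepsilon$ converge weakly on $\Omega$ to a Radon measure $\mu$ if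 $\int_\Omega f\,d\mu_\varepsilon\to\int_\Omega f\,d\mu$ as $\varepsilon\to0^+$ for every continuous $f$ with compact support in $\Omega$. (a) If $u\in W^{1,p}(\Omega)$, then the $\mu_\varepsilon$ and $d\mu(x)=K_{d,p}|\nabla u(x)|^p\,dx$ are Radon measures on $\Omega$, $\mu_\varepsilon$ converges weakly on $\Omega$ to $\mu$, and $\mu_\varepsilon(E)\to\mu(E)$ as $\varepsilon\to0^+$ for every compact set $E\subset\Omega$. (b) Let $p=1$ and $u\in BV(\Omega)$, i.e. $u\in L^1(\Omega)$ and $|u|_{BV(\Omega)}<\infty$, where for open $U\subset\Omega$ $$|u|_{BV(U)}=\sup\Big\{\int_U u\,\operatorname{div}\phi\,dx:\ \phi\in C_c^\infty(U,\mathbb{R}^d),\ |\phi|\le1\Big\}.$$ Then there is exactly one Borel measure $|\nabla u|$ on $\Omega$ with $|\nabla u|(U)=|u|_{BV(U)}$ for every open $U\subset\Omega$; the $\mu_\varepsilon$ and $\mu=K_{d,1}|\nabla u|$ are Radon measures on $\Omega$, $\mu_\varepsilon$ converges weakly on $\Omega$ to $\mu$, and $\mu_\varepsilon(E)\to\mu(E)$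 as $\varepsilon\to0^+$ for every compact set $E\subset\Omega$ with $|\nabla u|(\partial E)=0$. -/

import Mathlib

open MeasureTheory Filter Topology
open scoped ENNReal ContDiff

namespace NonlocalBV

noncomputable section

/-- A Dirac approximation of `p`-Lévy measures on `ℝ^d`: radial measurable functions `ν ε`,
`ε > 0`, with values in `[0, ∞]`, such that `∫ (1 ∧ |h|^p) ν_ε(h) dh = 1` and, for every `δ > 0`,
`∫_{|h| > δ} (1 ∧ |h|^p) ν_ε(h) dh → 0` as `ε → 0⁺`. The value at `h = 0` plays no role. -/
structure IsDiracApprox (d : ℕ) (p : ℝ) (ν : ℝ → EuclideanSpace ℝ (Fin d) → ℝ≥0∞) : Prop where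
  measurable : ∀ ε : ℝ, 0 < ε → AEMeasurable (ν ε) volume
  radial : ∀ ε : ℝ, 0 < ε → ∀ h k : EuclideanSpace ℝ (Fin d), ‖h‖ = ‖k‖ → ν ε h = ν ε k
  mass : ∀ ε : ℝ, 0 < ε → ∫⁻ h, min 1 (‖h‖ₑ ^ p) * ν ε h = 1
  concentration : ∀ δ : ℝ, 0 < δ →
    Tendsto (fun ε : ℝ => ∫⁻ h in {h : EuclideanSpace ℝ (Fin d) | δ < ‖h‖},
      min 1 (‖h‖ₑ ^ p) * ν ε h) (𝓝[>] 0) (𝓝 0)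

/-- The mean value of `|w · e|^p` over the unit sphere with respect to the surface measure. For
a unit vector `e` this is the constant `K_{d,p}`. -/
def sphereMean (d : ℕ) (p : ℝ) (e : EuclideanSpace ℝ (Fin d)) : ℝ :=
  ⨍ w : Metric.sphere (0 : EuclideanSpace ℝ (Fin d)) 1,
    |inner ℝ (w : EuclideanSpace ℝ (Fin d)) e| ^ p
    ∂((volume : Measure (EuclideanSpace ℝ (Fin d))).toSphere)

/-- The vector field `g` is the distributional gradient of `u` on `Ω`. -/
def HasWeakGradient {d : ℕ} (Ω : Set (EuclideanSpace ℝ (Fin d)))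
    (u : EuclideanSpace ℝ (Fin d) → ℝ)
    (g : EuclideanSpace ℝ (Fin d) → EuclideanSpace ℝ (Fin d)) : Prop :=
  ∀ φ : EuclideanSpace ℝ (Fin d) → ℝ, ContDiff ℝ ∞ φ → HasCompactSupport φ → tsupport φ ⊆ Ω →
    ∀ i : Fin d, ∫ x in Ω, u x * fderiv ℝ φ x (EuclideanSpace.single i 1) =
      - ∫ x in Ω, g x i * φ x

/-- `u ∈ W^{1,p}(Ω)` with weak gradient `∇u = g`. -/
structure IsSobolevWithGradient {d : ℕ} (p : ℝ) (Ω : Set (EuclideanSpace ℝ (Fin d)))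
    (u : EuclideanSpace ℝ (Fin d) → ℝ)
    (g : EuclideanSpace ℝ (Fin d) → EuclideanSpace ℝ (Fin d)) : Prop where
  memLp : MemLp u (ENNReal.ofReal p) (volume.restrict Ω)
  memLp_gradient : MemLp g (ENNReal.ofReal p) (volume.restrict Ω)
  gradient : HasWeakGradient Ω u g

/-- The divergence of a vector field on `ℝ^d`. -/
def divergence {d : ℕ} (φ : EuclideanSpace ℝ (Fin d) → EuclideanSpace ℝ (Fin d))
    (x : EuclideanSpace ℝ (Fin d)) : ℝ :=
  ∑ i : Fin d, (fderiv ℝ φ x (EuclideanSpace.single i 1)) i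

/-- The class of `φ ∈ C_c^∞(U, ℝ^d)` with `|φ| ≤ 1` everywhere. -/
def testFields {d : ℕ} (U : Set (EuclideanSpace ℝ (Fin d))) :
    Set (EuclideanSpace ℝ (Fin d) → EuclideanSpace ℝ (Fin d)) :=
  {φ | ContDiff ℝ ∞ φ ∧ HasCompactSupport φ ∧ tsupport φ ⊆ U ∧ ∀ x, ‖φ x‖ ≤ 1}

/-- The variation `|u|_{BV(U)} = sup {∫_U u div φ : φ ∈ C_c^∞(U, ℝ^d), |φ| ≤ 1} ∈ [0, ∞]`
(truncating at `0` is harmless since `φ = 0` is admissible). -/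
def bvVariation {d : ℕ} (U : Set (EuclideanSpace ℝ (Fin d)))
    (u : EuclideanSpace ℝ (Fin d) → ℝ) : ℝ≥0∞ :=
  ⨆ φ ∈ testFields U, ENNReal.ofReal (∫ x in U, u x * divergence φ x)

/-- `u ∈ BV(Ω)`. -/
def IsBV {d : ℕ} (Ω : Set (EuclideanSpace ℝ (Fin d)))
    (u : EuclideanSpace ℝ (Fin d) → ℝ) : Prop :=
  MemLp u 1 (volume.restrict Ω) ∧ bvVariation Ω u < ⊤

/-- `Λ` is the variation measure `|∇u|` of `u` on `Ω` (a measure on `ℝ^d` carried by `Ω`): its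
value on every open `U ⊆ Ω` is `|u|_{BV(U)}`. -/
def IsVariationMeasure {d : ℕ} (Ω : Set (EuclideanSpace ℝ (Fin d)))
    (u : EuclideanSpace ℝ (Fin d) → ℝ) (Λ : Measure (EuclideanSpace ℝ (Fin d))) : Prop :=
  Λ Ωᶜ = 0 ∧ ∀ U : Set (EuclideanSpace ℝ (Fin d)), IsOpen U → U ⊆ Ω → Λ U = bvVariation U u

/-- The measure `(∫_Ω |u(x) - u(y)|^p k(x - y) dy) dx` on `Ω`. -/
def nonlocalMeasure {d : ℕ} (p : ℝ) (Ω : Set (EuclideanSpace ℝ (Fin d)))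
    (k : EuclideanSpace ℝ (Fin d) → ℝ≥0∞) (u : EuclideanSpace ℝ (Fin d) → ℝ) :
    Measure (EuclideanSpace ℝ (Fin d)) :=
  (volume.restrict Ω).withDensity fun x => ∫⁻ y in Ω, ‖u x - u y‖ₑ ^ p * k (x - y)

/-- The measure `K |g(x)|^p dx` on `Ω`. -/
def gradientMeasure {d : ℕ} (K p : ℝ) (Ω : Set (EuclideanSpace ℝ (Fin d)))
    (g : EuclideanSpace ℝ (Fin d) → EuclideanSpace ℝ (Fin d)) :
    Measure (EuclideanSpace ℝ (Fin d)) :=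
  (volume.restrict Ω).withDensity fun x => ENNReal.ofReal K * ‖g x‖ₑ ^ p

/-- `m` is (the extension by zero of) a Radon measure on the open set `Ω`. -/
def IsRadonOn {d : ℕ} (Ω : Set (EuclideanSpace ℝ (Fin d)))
    (m : Measure (EuclideanSpace ℝ (Fin d))) : Prop :=
  m Ωᶜ = 0 ∧ ∀ E : Set (EuclideanSpace ℝ (Fin d)), IsCompact E → E ⊆ Ω → m E < ⊤

/-- Weak convergence of Radon measures on `Ω` as `ε → 0⁺`: convergence of the integrals of all
continuous functions with compact support in `Ω`. -/
def ConvergesWeaklyOn {d : ℕ} (Ω : Set (EuclideanSpace ℝ (Fin d)))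
    (μ : ℝ → Measure (EuclideanSpace ℝ (Fin d)))
    (m : Measure (EuclideanSpace ℝ (Fin d))) : Prop :=
  ∀ f : EuclideanSpace ℝ (Fin d) → ℝ, Continuous f → HasCompactSupport f → tsupport f ⊆ Ω →
    Tendsto (fun ε : ℝ => ∫ x, f x ∂(μ ε)) (𝓝[>] 0) (𝓝 (∫ x, f x ∂m))

end

end NonlocalBV

/-! ### Two convexity inequalities for p-th powers -/

namespace NonlocalBV

/-! Replace `u` by its extension by zero `v`, which is in `L^p(ℝ^d)` whatever `Ω` is. With `y = x +
h`, the number `μ_ε(E)` is the integral over `x ∈ E` and over `h`, against `m = ν_ε(h) dh`, of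
`|v(x+h) - v(x)|^p`, where only pairs with `x + h ∈ Ω` count. Split at `|h| = τ`. The far part is at
most a constant times `‖v‖_p^p m{|h| > τ}` and vanishes as `ε → 0`. In the near part, once `τ` is
smaller than the distance from the compact set `E` to the complement of `Ω`, the boundary is
invisible; hence no regularity of `Ω` is needed.

The constant arises from rotation invariance: the integral of `|a·h|^p` over the ball `|h| ≤ τ`
equals `K |a|^p` times that of `|h|^p` (`IsRadialLevy.setLIntegral_enorm_inner_rpow`), and the
latter tends to 1. It remains to compare increments with linear terms.

Sobolev case: the Taylor remainder satisfies `∫_E |v(x+h) - v(x) - G(x)·h|^p dx ≤ η |h|^p` for small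
`h`, by continuity of translations of the gradient in `L^p` (`sobolev_remainder_le`). The inequality
`(a+b)^p ≤ θ a^p + C b^p`, with `θ > 1` arbitrary, turns this into bounds from both sides, uniform
in `ε`, and gives the limit on every compact set (`sobolev_energy_bounds`).

BV case: for the upper bound, mollify, bound increments by directional derivatives along segments,
and average over rotations; Fatou's lemma then bounds the near energy on `E` by `K` times the
variation on a neighbourhood of `E` (`shortEnergy_le_totalVariation`). Shrinking the neighbourhood
gives the limsup bound on compact sets. For the lower bound on an open `U`, mollification decreases
the near energy up to a slight enlargement of the set, and for the smooth mollified function the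
Taylor argument is elementary. The duality `∫ v div(ρ * φ) = -∫ ∇(ρ * v)·φ`
(`integral_mul_divergence_mollify`) recovers the variation when the mollifier shrinks
(`totalVariation_le_liminf`). Both bounds agree on compact sets with null frontier.

The variation measure exists because the variation of open sets is countably subadditive and is
superadditive on disjoint sets, so that it induces a metric outer measure. Weak convergence follows
from convergence on compact sets with null frontier by the layer cake formula
(`convergesWeaklyOn_of_tendsto_compact`). -/

theorem exists_forall_add_rpow_le {p : ℝ} (hp : 1 ≤ p) {θ : ℝ≥0∞} (hθ : 1 < θ) :
    ∃ C : ℝ≥0∞, C ≠ ⊤ ∧ ∀ a b : ℝ≥0∞, (a + b) ^ p ≤ θ * a ^ p + C * b ^ p := by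
  -- Convexity applied to `a + b = (1-s)(a/(1-s)) + s(b/s)` yields the coefficients `(1-s)^(1-p)`
  -- and `s^(1-p)`. The first tends to 1 as `s → 0`, hence is below `θ` for some `s`; the second is
  -- then the constant `C`.
  have hlim : Tendsto (fun s : ℝ => ENNReal.ofReal (1 - s) ^ (1 - p)) (𝓝[>] 0) (𝓝 1) := by
    have h1 : Tendsto (fun s : ℝ => ENNReal.ofReal (1 - s)) (𝓝[>] 0) (𝓝 1) := by
      have : Tendsto (fun s : ℝ => ENNReal.ofReal (1 - s)) (𝓝 0) (𝓝 (ENNReal.ofReal (1 - 0))) :=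
        ENNReal.tendsto_ofReal ((continuous_const.sub continuous_id).tendsto 0)
      rw [sub_zero, ENNReal.ofReal_one] at this
      exact this.mono_left nhdsWithin_le_nhds
    have := h1.ennrpow_const (1 - p)
    rwa [ENNReal.one_rpow] at this
  have hev : ∀ᶠ s : ℝ in 𝓝[>] 0, ENNReal.ofReal (1 - s) ^ (1 - p) < θ :=
    hlim.eventually_lt_const hθ
  have hev2 : ∀ᶠ s : ℝ in 𝓝[>] 0, s ∈ Set.Ioo (0 : ℝ) 1 := Ioo_mem_nhdsGT one_pos
  obtain ⟨s, hs, hs0, hs1⟩ := (hev.and hev2).exists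
  have key : ∀ t : ℝ, 0 < t → ∀ a : ℝ≥0∞,
      ENNReal.ofReal t * (a / ENNReal.ofReal t) ^ p = ENNReal.ofReal t ^ (1 - p) * a ^ p := by
    intro t ht a
    have ht0 : ENNReal.ofReal t ≠ 0 := by simpa using ht
    rw [ENNReal.div_rpow_of_nonneg _ _ (by linarith), div_eq_mul_inv,
      ENNReal.rpow_sub _ _ ht0 ENNReal.ofReal_ne_top, ENNReal.rpow_one, div_eq_mul_inv]
    ring
  refine ⟨ENNReal.ofReal s ^ (1 - p), ?_, fun a b => ?_⟩
  · exact ENNReal.rpow_ne_top_of_ne_zero (by simpa using hs0) ENNReal.ofReal_ne_top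
  · have hw : ENNReal.ofReal (1 - s) + ENNReal.ofReal s = 1 := by
      rw [← ENNReal.ofReal_add (by linarith) hs0.le]; simp
    have := ENNReal.rpow_arith_mean_le_arith_mean2_rpow (ENNReal.ofReal (1 - s)) (ENNReal.ofReal s)
      (a / ENNReal.ofReal (1 - s)) (b / ENNReal.ofReal s) hw hp
    rw [key _ (by linarith), key _ hs0,
      ENNReal.mul_div_cancel (by simpa using hs1) ENNReal.ofReal_ne_top,
      ENNReal.mul_div_cancel (by simpa using hs0) ENNReal.ofReal_ne_top] at this
    refine this.trans ?_
    gcongr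

/-- Jensen's inequality, by Hölder against the constant 1. The case `p = 1` is split off because it
has no finite conjugate exponent. -/
theorem lintegral_rpow_le_lintegral_rpow {α : Type*} [MeasurableSpace α] {P : Measure α}
    [IsProbabilityMeasure P] {p : ℝ} (hp : 1 ≤ p) {f : α → ℝ≥0∞} (hf : AEMeasurable f P) :
    (∫⁻ x, f x ∂P) ^ p ≤ ∫⁻ x, f x ^ p ∂P := by
  rcases hp.eq_or_lt with rfl | hp
  · simp
  have hpq := Real.HolderConjugate.conjExponent hp
  have h := ENNReal.lintegral_mul_le_Lp_mul_Lq P hpq hf (aemeasurable_const (b := (1 : ℝ≥0∞)))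
  simp only [Pi.mul_apply, mul_one, ENNReal.one_rpow, lintegral_const, measure_univ] at h
  calc (∫⁻ x, f x ∂P) ^ p ≤ ((∫⁻ x, f x ^ p ∂P) ^ (1 / p)) ^ p := by gcongr
    _ = ∫⁻ x, f x ^ p ∂P := by
      rw [← ENNReal.rpow_mul, one_div_mul_cancel (by linarith), ENNReal.rpow_one]

/-! ### Rotation invariant measures and the constant `K_{d,p}` -/

section Rotation

open scoped Pointwise

variable {V : Type*} [NormedAddCommGroup V] [InnerProductSpace ℝ V] [MeasurableSpace V]
  [BorelSpace V]

theorem exists_linearIsometryEquiv_apply_eq {V : Type*} [NormedAddCommGroup V]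
    [InnerProductSpace ℝ V] {a b : V} (h : ‖a‖ = ‖b‖) :
    ∃ L : V ≃ₗᵢ[ℝ] V, L a = b :=
  ⟨(ℝ ∙ (a - b))ᗮ.reflection, Submodule.reflection_sub h⟩

/-- The surface measure of a set is a multiple of the measure of the cone over it, and forming the
cone commutes with linear isometries. -/
theorem measurePreserving_sphere_map (μ : Measure V) (L : V ≃ₗᵢ[ℝ] V)
    (hL : MeasurePreserving L μ μ) :
    MeasurePreserving (fun w : Metric.sphere (0 : V) 1 =>
      (⟨L w, by simp⟩ : Metric.sphere (0 : V) 1)) μ.toSphere μ.toSphere := by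
  have hmeas : Measurable (fun w : Metric.sphere (0 : V) 1 =>
      (⟨L w, by simp⟩ : Metric.sphere (0 : V) 1)) :=
    (L.continuous.measurable.comp measurable_subtype_coe).subtype_mk
  refine ⟨hmeas, Measure.ext fun s hs => ?_⟩
  rw [Measure.map_apply hmeas hs, μ.toSphere_apply' (hmeas hs), μ.toSphere_apply' hs]
  congr 1
  have : Set.Ioo (0 : ℝ) 1 • (Subtype.val '' ((fun w : Metric.sphere (0 : V) 1 =>
      (⟨L w, by simp⟩ : Metric.sphere (0 : V) 1)) ⁻¹' s)) =
      L ⁻¹' (Set.Ioo (0 : ℝ) 1 • (Subtype.val '' s)) := by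
    ext x
    simp only [Set.mem_smul, Set.mem_image, Set.mem_preimage, exists_exists_and_eq_and]
    constructor
    · rintro ⟨r, hr, w, hw, rfl⟩
      exact ⟨r, hr, _, hw, by simp⟩
    · rintro ⟨r, hr, w, hw, h⟩
      refine ⟨r, hr, ⟨L.symm w, by simp⟩, by simpa using hw, ?_⟩
      apply L.injective
      simpa using h
  rw [this]
  exact hL.measure_preimage_equiv (f := L.toHomeomorph.toMeasurableEquiv) _

theorem lintegral_sphere_enorm_inner_rpow (μ : Measure V)
    (hμ : ∀ L : V ≃ₗᵢ[ℝ] V, MeasurePreserving L μ μ)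
    {p : ℝ} (hp : 0 < p) {e : V} (he : ‖e‖ = 1) (h : V) :
    ∫⁻ w : Metric.sphere (0 : V) 1, ‖inner ℝ (w : V) h‖ₑ ^ p ∂μ.toSphere =
      ‖h‖ₑ ^ p * ∫⁻ w : Metric.sphere (0 : V) 1, ‖inner ℝ (w : V) e‖ₑ ^ p ∂μ.toSphere := by
  have hm : ∀ k : V, Measurable fun w : Metric.sphere (0 : V) 1 => ‖inner ℝ (w : V) k‖ₑ ^ p := by
    intro k
    have : Continuous fun w : Metric.sphere (0 : V) 1 => inner ℝ (w : V) k := by fun_prop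
    exact this.measurable.enorm.pow_const p
  obtain ⟨L, hL⟩ := exists_linearIsometryEquiv_apply_eq (a := ‖h‖ • e) (b := h)
    (by simp [norm_smul, he])
  rw [← lintegral_const_mul _ (hm e),
    ← (measurePreserving_sphere_map μ L (hμ L)).lintegral_comp (hm h)]
  refine lintegral_congr fun w => ?_
  rw [← ENNReal.mul_rpow_of_nonneg _ _ hp.le]
  congr 1
  conv_lhs => rw [← hL]
  simp only [LinearIsometryEquiv.inner_map_map, real_inner_smul_right, enorm_mul, enorm_norm]

variable [FiniteDimensional ℝ V]

/-- Integrate `|w·h|^p` over sphere and space in both orders. Invariance of `m` makes the integral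
in `h` independent of `w`; invariance of `μ` makes the integral in `w` a fixed multiple of `‖h‖^p`.
The product form avoids dividing by a mass that could be zero. -/
theorem lintegral_sphere_mul_lintegral_enorm_inner_rpow (μ m : Measure V) [SFinite m]
    (hμ : ∀ L : V ≃ₗᵢ[ℝ] V, MeasurePreserving L μ μ)
    (hm : ∀ L : V ≃ₗᵢ[ℝ] V, MeasurePreserving L m m) [IsFiniteMeasure μ.toSphere]
    {p : ℝ} (hp : 0 < p) {e : V} (he : ‖e‖ = 1) (a : V) :
    μ.toSphere Set.univ * ∫⁻ h, ‖inner ℝ a h‖ₑ ^ p ∂m =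
      (∫⁻ w : Metric.sphere (0 : V) 1, ‖inner ℝ (w : V) e‖ₑ ^ p ∂μ.toSphere) *
        (‖a‖ₑ ^ p * ∫⁻ h, ‖h‖ₑ ^ p ∂m) := by
  have hmeas : ∀ k : V, Measurable fun h : V => ‖inner ℝ k h‖ₑ ^ p := by
    intro k
    have : Continuous fun h : V => inner ℝ k h := by fun_prop
    exact this.measurable.enorm.pow_const p
  have hrot : ∀ w : Metric.sphere (0 : V) 1,
      ∫⁻ h, ‖inner ℝ a h‖ₑ ^ p ∂m = ‖a‖ₑ ^ p * ∫⁻ h, ‖inner ℝ (w : V) h‖ₑ ^ p ∂m := by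
    intro w
    obtain ⟨L, hL⟩ := exists_linearIsometryEquiv_apply_eq (a := ‖a‖ • (w : V)) (b := a)
      (by simp [norm_smul])
    rw [← lintegral_const_mul _ (hmeas w), ← (hm L).lintegral_comp (hmeas a)]
    refine lintegral_congr fun h => ?_
    rw [← ENNReal.mul_rpow_of_nonneg _ _ hp.le]
    congr 1
    conv_lhs => rw [← hL]
    simp only [LinearIsometryEquiv.inner_map_map, real_inner_smul_left, enorm_mul, enorm_norm]
  have hjoint : Measurable (fun q : Metric.sphere (0 : V) 1 × V =>
      ‖inner ℝ (q.1 : V) q.2‖ₑ ^ p) := by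
    have : Continuous fun q : Metric.sphere (0 : V) 1 × V => inner ℝ (q.1 : V) q.2 := by fun_prop
    exact this.measurable.enorm.pow_const p
  calc μ.toSphere Set.univ * ∫⁻ h, ‖inner ℝ a h‖ₑ ^ p ∂m
      = ∫⁻ _ : Metric.sphere (0 : V) 1, ∫⁻ h, ‖inner ℝ a h‖ₑ ^ p ∂m ∂μ.toSphere := by
        rw [lintegral_const, mul_comm]
    _ = ∫⁻ w : Metric.sphere (0 : V) 1, ‖a‖ₑ ^ p * ∫⁻ h, ‖inner ℝ (w : V) h‖ₑ ^ p ∂m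
          ∂μ.toSphere := lintegral_congr hrot
    _ = ‖a‖ₑ ^ p * ∫⁻ w : Metric.sphere (0 : V) 1, ∫⁻ h, ‖inner ℝ (w : V) h‖ₑ ^ p ∂m
          ∂μ.toSphere := lintegral_const_mul _ hjoint.lintegral_prod_right'
    _ = ‖a‖ₑ ^ p * ∫⁻ h, ∫⁻ w : Metric.sphere (0 : V) 1, ‖inner ℝ (w : V) h‖ₑ ^ p ∂μ.toSphere
          ∂m := by rw [lintegral_lintegral_swap hjoint.aemeasurable]
    _ = ‖a‖ₑ ^ p * ((∫⁻ h, ‖h‖ₑ ^ p ∂m) *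
          ∫⁻ w : Metric.sphere (0 : V) 1, ‖inner ℝ (w : V) e‖ₑ ^ p ∂μ.toSphere) := by
        rw [lintegral_congr (lintegral_sphere_enorm_inner_rpow μ hμ hp he), lintegral_mul_const _ (measurable_enorm.pow_const p)]
    _ = _ := by ring

end Rotation

theorem ofReal_sphereMean (d : ℕ) {p : ℝ} (hp : 0 < p) (e : EuclideanSpace ℝ (Fin d)) :
    ENNReal.ofReal (sphereMean d p e) =
      ((volume : Measure (EuclideanSpace ℝ (Fin d))).toSphere Set.univ)⁻¹ *
      ∫⁻ w : Metric.sphere (0 : EuclideanSpace ℝ (Fin d)) 1,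
        ‖inner ℝ (w : EuclideanSpace ℝ (Fin d)) e‖ₑ ^ p
        ∂(volume : Measure (EuclideanSpace ℝ (Fin d))).toSphere := by
  have hcont : Continuous fun w : Metric.sphere (0 : EuclideanSpace ℝ (Fin d)) 1 =>
      |inner ℝ (w : EuclideanSpace ℝ (Fin d)) e| ^ p :=
    Continuous.rpow_const (by fun_prop) fun _ => Or.inr hp.le
  rw [sphereMean, average_eq', ofReal_integral_eq_lintegral_ofReal, lintegral_smul_measure,
    smul_eq_mul]
  · congr 1
    refine lintegral_congr fun w => ?_
    rw [← ENNReal.ofReal_rpow_of_nonneg (abs_nonneg _) hp.le, ← Real.norm_eq_abs, ofReal_norm]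
  -- In dimension zero the surface measure vanishes and its inverse mass is infinite, so
  -- integrability for the rescaled measure needs a separate argument.
  · rcases eq_or_ne ((volume : Measure (EuclideanSpace ℝ (Fin d))).toSphere Set.univ) 0 with h0 | h0
    · rw [Measure.measure_univ_eq_zero.1 h0]; simp
    · refine Integrable.smul_measure ?_ (by simpa using h0)
      refine Integrable.of_bound hcont.aestronglyMeasurable (‖e‖ ^ p) (Eventually.of_forall ?_)
      intro w
      rw [Real.norm_of_nonneg (by positivity)]
      gcongr
      simpa using abs_real_inner_le_norm (w : EuclideanSpace ℝ (Fin d)) e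
  · exact Eventually.of_forall fun w => by positivity

theorem lintegral_enorm_inner_rpow {d : ℕ} (m : Measure (EuclideanSpace ℝ (Fin d))) [SFinite m]
    (hm : ∀ L : EuclideanSpace ℝ (Fin d) ≃ₗᵢ[ℝ] EuclideanSpace ℝ (Fin d), MeasurePreserving L m m)
    {p : ℝ} (hp : 0 < p) {e : EuclideanSpace ℝ (Fin d)} (he : ‖e‖ = 1)
    (a : EuclideanSpace ℝ (Fin d)) :
    ∫⁻ h, ‖inner ℝ a h‖ₑ ^ p ∂m =
      ENNReal.ofReal (sphereMean d p e) * (‖a‖ₑ ^ p * ∫⁻ h, ‖h‖ₑ ^ p ∂m) := by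
  -- The existence of a unit vector forces `d ≥ 1`, so the sphere has positive mass and can be
  -- divided out.
  have : Nontrivial (EuclideanSpace ℝ (Fin d)) :=
    ⟨⟨e, 0, by rw [← norm_ne_zero_iff, he]; exact one_ne_zero⟩⟩
  have h := lintegral_sphere_mul_lintegral_enorm_inner_rpow volume m
    (fun L => L.measurePreserving) hm hp he a
  set S := (volume : Measure (EuclideanSpace ℝ (Fin d))).toSphere Set.univ with hS
  have hS0 : S ≠ 0 := by
    rw [hS, Ne, Measure.measure_univ_eq_zero]
    exact Measure.toSphere_ne_zero _
  rw [ofReal_sphereMean d hp e, mul_assoc, ← h, ← mul_assoc,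
    ENNReal.inv_mul_cancel hS0 (measure_ne_top _ _), one_mul]

/-- A rotation invariant measure `m` with `∫ (1 ∧ |h|^p) dm = 1`. -/
structure IsRadialLevy {d : ℕ} (p : ℝ) (m : Measure (EuclideanSpace ℝ (Fin d))) : Prop where
  rotation : ∀ L : EuclideanSpace ℝ (Fin d) ≃ₗᵢ[ℝ] EuclideanSpace ℝ (Fin d),
    MeasurePreserving L m m
  mass : ∫⁻ h, min 1 (‖h‖ₑ ^ p) ∂m = 1

/-- The energy estimates below are uniform over this class of measures, so that one radius `τ`
serves all `ε` at once. -/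
theorem IsDiracApprox.isRadialLevy {d : ℕ} {p : ℝ} {ν : ℝ → EuclideanSpace ℝ (Fin d) → ℝ≥0∞}
    (hν : IsDiracApprox d p ν) {ε : ℝ} (hε : 0 < ε) :
    IsRadialLevy p (volume.withDensity (ν ε)) where
  rotation L := by
    refine ⟨L.continuous.measurable, Measure.ext fun s hs => ?_⟩
    rw [Measure.map_apply L.continuous.measurable hs, withDensity_apply _ hs,
      withDensity_apply _ (L.continuous.measurable hs),
      ← L.measurePreserving.setLIntegral_comp_preimage_emb
        L.toHomeomorph.measurableEmbedding (ν ε) s]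
    exact lintegral_congr fun h => hν.radial ε hε _ _ (by simp)
  mass := by
    rw [lintegral_withDensity_eq_lintegral_mul₀ (hν.measurable ε hε)]
    · exact (lintegral_congr fun h => mul_comm _ _).trans (hν.mass ε hε)
    · exact (measurable_const.min (measurable_enorm.pow_const p)).aemeasurable

theorem IsDiracApprox.tendsto_lintegral {d : ℕ} {p : ℝ}
    {ν : ℝ → EuclideanSpace ℝ (Fin d) → ℝ≥0∞}
    (hν : IsDiracApprox d p ν) {τ : ℝ} (hτ : 0 < τ) :
    Tendsto (fun ε => ∫⁻ h in {h | τ < ‖h‖}, min 1 (‖h‖ₑ ^ p) ∂(volume.withDensity (ν ε)))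
      (𝓝[>] 0) (𝓝 0) := by
  refine (hν.concentration τ hτ).congr' ?_
  filter_upwards [self_mem_nhdsWithin] with ε hε
  have hS : MeasurableSet {h : EuclideanSpace ℝ (Fin d) | τ < ‖h‖} :=
    measurableSet_lt measurable_const measurable_norm
  rw [restrict_withDensity hS,
    lintegral_withDensity_eq_lintegral_mul₀ (hν.measurable ε hε).restrict]
  · exact lintegral_congr fun h => mul_comm _ _
  · exact (measurable_const.min (measurable_enorm.pow_const p)).aemeasurable

/-! ### Mass of a Lévy measure near and far from the origin -/

section Levy

variable {d : ℕ} {p : ℝ} {m : Measure (EuclideanSpace ℝ (Fin d))}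

/-- Chebyshev: `1 ∧ |h|^p` is at least `1 ∧ τ^p` where `|h| > τ`. -/
theorem measure_norm_gt_le (m : Measure (EuclideanSpace ℝ (Fin d))) (hp : 0 < p) {τ : ℝ}
    (hτ : 0 < τ) :
    m {h | τ < ‖h‖} ≤ (min 1 (ENNReal.ofReal τ ^ p))⁻¹ *
      ∫⁻ h in {h | τ < ‖h‖}, min 1 (‖h‖ₑ ^ p) ∂m := by
  have hS : MeasurableSet {h : EuclideanSpace ℝ (Fin d) | τ < ‖h‖} :=
    measurableSet_lt measurable_const measurable_norm
  set c := min 1 (ENNReal.ofReal τ ^ p) with hc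
  have hc0 : c ≠ 0 := by
    have : ENNReal.ofReal τ ^ p ≠ 0 := by
      simp [ENNReal.rpow_eq_zero_iff, hτ]
    exact (lt_min one_pos (pos_iff_ne_zero.2 this)).ne'
  have hct : c ≠ ⊤ := ne_top_of_le_ne_top ENNReal.one_ne_top (min_le_left _ _)
  have : c * m {h | τ < ‖h‖} ≤ ∫⁻ h in {h | τ < ‖h‖}, min 1 (‖h‖ₑ ^ p) ∂m := by
    rw [← setLIntegral_const]
    refine setLIntegral_mono_ae' hS (Eventually.of_forall fun h hh => ?_)
    refine min_le_min_left _ ?_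
    gcongr
    rw [← ofReal_norm]
    exact ENNReal.ofReal_le_ofReal (le_of_lt hh)
  calc m {h | τ < ‖h‖} = c⁻¹ * (c * m {h | τ < ‖h‖}) := by
        rw [← mul_assoc, ENNReal.inv_mul_cancel hc0 hct, one_mul]
    _ ≤ _ := by gcongr

theorem IsRadialLevy.measure_norm_gt_ne_top (hm : IsRadialLevy p m) (hp : 0 < p) {τ : ℝ}
    (hτ : 0 < τ) : m {h | τ < ‖h‖} ≠ ⊤ := by
  refine ne_top_of_le_ne_top ?_ (measure_norm_gt_le m hp hτ)
  refine ENNReal.mul_ne_top (ENNReal.inv_ne_top.2 ?_) ?_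
  · exact (lt_min one_pos (by rw [pos_iff_ne_zero]; simp [ENNReal.rpow_eq_zero_iff, hτ])).ne'
  · exact ne_top_of_le_ne_top ENNReal.one_ne_top ((setLIntegral_le_lintegral _ _).trans hm.mass.le)

theorem IsDiracApprox.tendsto_measure_norm_gt {ν : ℝ → EuclideanSpace ℝ (Fin d) → ℝ≥0∞}
    (hν : IsDiracApprox d p ν) (hp : 0 < p) {τ : ℝ} (hτ : 0 < τ) :
    Tendsto (fun ε => (volume.withDensity (ν ε)) {h | τ < ‖h‖}) (𝓝[>] 0) (𝓝 0) := by
  refine tendsto_of_tendsto_of_tendsto_of_le_of_le tendsto_const_nhds ?_ (fun _ => zero_le)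
    (fun ε => measure_norm_gt_le _ hp hτ)
  have := ENNReal.Tendsto.const_mul (a := (min 1 (ENNReal.ofReal τ ^ p))⁻¹)
    (hν.tendsto_lintegral hτ) (Or.inr (ENNReal.inv_ne_top.2 ?_))
  · simpa using this
  · exact (lt_min one_pos (by rw [pos_iff_ne_zero]; simp [ENNReal.rpow_eq_zero_iff, hτ])).ne'

theorem compl_closedBall_zero (τ : ℝ) :
    (Metric.closedBall (0 : EuclideanSpace ℝ (Fin d)) τ)ᶜ = {h | τ < ‖h‖} := by
  ext h; simp

/-- For `τ ≤ 1` the truncation at 1 is inactive in the ball. The near mass is therefore 1 minus a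
far mass which concentration sends to zero. -/
theorem IsRadialLevy.setLIntegral_closedBall_add (hm : IsRadialLevy p m) (hp : 0 < p) {τ : ℝ}
    (hτ : τ ≤ 1) :
    ∫⁻ h in Metric.closedBall 0 τ, ‖h‖ₑ ^ p ∂m +
      ∫⁻ h in {h | τ < ‖h‖}, min 1 (‖h‖ₑ ^ p) ∂m = 1 := by
  refine Eq.trans ?_ hm.mass
  refine Eq.trans ?_ (lintegral_add_compl (fun h => min 1 (‖h‖ₑ ^ p)) (measurableSet_closedBall
    (x := (0 : EuclideanSpace ℝ (Fin d))) (ε := τ)))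
  rw [compl_closedBall_zero]
  congr 1
  refine setLIntegral_congr_fun
    (measurableSet_closedBall (x := (0 : EuclideanSpace ℝ (Fin d)))) fun h hh => ?_
  rw [mem_closedBall_zero_iff] at hh
  refine (min_eq_right (ENNReal.rpow_le_one ?_ hp.le)).symm
  rw [← ofReal_norm, ← ENNReal.ofReal_one]
  exact ENNReal.ofReal_le_ofReal (hh.trans hτ)

theorem IsRadialLevy.setLIntegral_closedBall_le_one (hm : IsRadialLevy p m) (hp : 0 < p) {τ : ℝ}
    (hτ : τ ≤ 1) : ∫⁻ h in Metric.closedBall 0 τ, ‖h‖ₑ ^ p ∂m ≤ 1 :=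
  (le_self_add).trans (hm.setLIntegral_closedBall_add hp hτ).le

theorem IsDiracApprox.tendsto_setLIntegral_closedBall
    {ν : ℝ → EuclideanSpace ℝ (Fin d) → ℝ≥0∞}
    (hν : IsDiracApprox d p ν) (hp : 0 < p) {τ : ℝ} (hτ : 0 < τ) (hτ1 : τ ≤ 1) :
    Tendsto (fun ε => ∫⁻ h in Metric.closedBall 0 τ, ‖h‖ₑ ^ p ∂(volume.withDensity (ν ε)))
      (𝓝[>] 0) (𝓝 1) := by
  have h := ENNReal.Tendsto.sub (tendsto_const_nhds (x := (1 : ℝ≥0∞)) (f := 𝓝[>] (0 : ℝ)))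
    (hν.tendsto_lintegral hτ) (Or.inl ENNReal.one_ne_top)
  rw [tsub_zero] at h
  refine h.congr' ?_
  filter_upwards [self_mem_nhdsWithin] with ε hε
  have h1 := (hν.isRadialLevy hε).setLIntegral_closedBall_add hp hτ1
  refine ENNReal.sub_eq_of_eq_add ?_ h1.symm
  exact ne_top_of_le_ne_top ENNReal.one_ne_top (le_add_self.trans h1.le)

/-- The ball is rotation invariant, hence so is `m` restricted to it. Through this identity `K`
enters the limit. -/
theorem IsRadialLevy.setLIntegral_enorm_inner_rpow [SFinite m] (hm : IsRadialLevy p m)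
    (hp : 0 < p) {e : EuclideanSpace ℝ (Fin d)} (he : ‖e‖ = 1) (τ : ℝ)
    (a : EuclideanSpace ℝ (Fin d)) :
    ∫⁻ h in Metric.closedBall 0 τ, ‖inner ℝ a h‖ₑ ^ p ∂m =
      ENNReal.ofReal (sphereMean d p e) *
        (‖a‖ₑ ^ p * ∫⁻ h in Metric.closedBall 0 τ, ‖h‖ₑ ^ p ∂m) := by
  refine lintegral_enorm_inner_rpow _ (fun L => ?_) hp he a
  have h := (hm.rotation L).restrict_preimage
    (Metric.isClosed_closedBall (x := (0 : EuclideanSpace ℝ (Fin d))) (ε := τ)).measurableSet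
  have h2 : L ⁻¹' Metric.closedBall 0 τ = Metric.closedBall 0 τ := by ext; simp
  rwa [h2] at h

end Levy

/-- The short range part of the nonlocal energy of `v` on `A`. -/
noncomputable def shortEnergy {d : ℕ} (p : ℝ) (m : Measure (EuclideanSpace ℝ (Fin d))) (τ : ℝ)
    (A : Set (EuclideanSpace ℝ (Fin d))) (v : EuclideanSpace ℝ (Fin d) → ℝ) : ℝ≥0∞ :=
  ∫⁻ h in Metric.closedBall 0 τ, (∫⁻ x in A, ‖v (x + h) - v x‖ₑ ^ p) ∂m

/-! ### Short range and full nonlocal energies -/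

section Energy

variable {d : ℕ} {p : ℝ} {m : Measure (EuclideanSpace ℝ (Fin d))} [SFinite m]
  {v : EuclideanSpace ℝ (Fin d) → ℝ} {g : EuclideanSpace ℝ (Fin d) → EuclideanSpace ℝ (Fin d)}
  {A Ω : Set (EuclideanSpace ℝ (Fin d))}

theorem measurable_enorm_increment (p : ℝ) (hv : Measurable v) :
    Measurable fun q : EuclideanSpace ℝ (Fin d) × EuclideanSpace ℝ (Fin d) =>
      ‖v (q.1 + q.2) - v q.1‖ₑ ^ p :=
  (((hv.comp (measurable_fst.add measurable_snd)).sub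
    (hv.comp measurable_fst)).enorm).pow_const p

theorem shortEnergy_eq_swap (hv : Measurable v) (τ : ℝ) :
    shortEnergy p m τ A v =
      ∫⁻ x in A, ∫⁻ h in Metric.closedBall 0 τ, ‖v (x + h) - v x‖ₑ ^ p ∂m := by
  rw [shortEnergy, lintegral_lintegral_swap]
  exact ((measurable_enorm_increment p hv).comp measurable_swap).aemeasurable

/-- The nonlocal energy of `u` on `A`, interactions with points outside of `Ω` being left out. -/
noncomputable def nonlocalEnergy {d : ℕ} (p : ℝ) (m : Measure (EuclideanSpace ℝ (Fin d)))
    (Ω A : Set (EuclideanSpace ℝ (Fin d))) (v : EuclideanSpace ℝ (Fin d) → ℝ) : ℝ≥0∞ :=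
  ∫⁻ x in A, ∫⁻ h, Ω.indicator (fun y => ‖v y - v x‖ₑ ^ p) (x + h) ∂m

theorem shortEnergy_le_nonlocalEnergy (hv : Measurable v) {τ : ℝ} (hA : MeasurableSet A)
    (hΩ : ∀ x ∈ A, ∀ h, ‖h‖ ≤ τ → x + h ∈ Ω) :
    shortEnergy p m τ A v ≤ nonlocalEnergy p m Ω A v := by
  rw [shortEnergy_eq_swap hv]
  refine setLIntegral_mono' hA fun x hx => ?_
  refine le_trans ?_ (setLIntegral_le_lintegral (Metric.closedBall 0 τ) _)
  refine setLIntegral_mono' measurableSet_closedBall fun h hh => ?_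
  rw [Set.indicator_of_mem (hΩ x hx h (by simpa using hh))]

/-- Far interactions need no regularity: `|a - b|^p ≤ 2^(p-1)(|a|^p + |b|^p)` and translation
invariance bound the integral in `x` independently of `h`. -/
theorem setLIntegral_norm_gt_increment_le (hp : 1 ≤ p) (hv : Measurable v) (τ : ℝ) :
    ∫⁻ x in A, ∫⁻ h in {h | τ < ‖h‖}, ‖v (x + h) - v x‖ₑ ^ p ∂m ≤
      2 ^ (p - 1) * (2 * ∫⁻ x, ‖v x‖ₑ ^ p) * m {h | τ < ‖h‖} := by
  have hvp : Measurable fun x => ‖v x‖ₑ ^ p := hv.enorm.pow_const p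
  rw [lintegral_lintegral_swap (measurable_enorm_increment p hv).aemeasurable]
  calc ∫⁻ h in {h | τ < ‖h‖}, (∫⁻ x in A, ‖v (x + h) - v x‖ₑ ^ p) ∂m
      ≤ ∫⁻ h in {h | τ < ‖h‖}, 2 ^ (p - 1) * (2 * ∫⁻ x, ‖v x‖ₑ ^ p) ∂m := by
        refine lintegral_mono fun h => ?_
        calc ∫⁻ x in A, ‖v (x + h) - v x‖ₑ ^ p
            ≤ ∫⁻ x, ‖v (x + h) - v x‖ₑ ^ p := setLIntegral_le_lintegral _ _
          _ ≤ ∫⁻ x, 2 ^ (p - 1) * (‖v (x + h)‖ₑ ^ p + ‖v x‖ₑ ^ p) := by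
            refine lintegral_mono fun x => ?_
            refine le_trans ?_ (ENNReal.rpow_add_le_mul_rpow_add_rpow _ _ hp)
            gcongr
            exact enorm_sub_le
          _ = 2 ^ (p - 1) * (2 * ∫⁻ x, ‖v x‖ₑ ^ p) := by
            rw [lintegral_const_mul, lintegral_add_right _ hvp,
              lintegral_add_right_eq_self (fun x => ‖v x‖ₑ ^ p), two_mul]
            exact (hvp.comp (measurable_add_const h)).add hvp
    _ = _ := by rw [setLIntegral_const]

theorem nonlocalEnergy_le (hp : 1 ≤ p) (hv : Measurable v) (τ : ℝ) :
    nonlocalEnergy p m Ω A v ≤ shortEnergy p m τ A v +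
      2 ^ (p - 1) * (2 * ∫⁻ x, ‖v x‖ₑ ^ p) * m {h | τ < ‖h‖} := by
  refine le_trans ?_ (add_le_add_right (setLIntegral_norm_gt_increment_le (A := A) hp hv τ) _)
  rw [shortEnergy_eq_swap hv, ← lintegral_add_left, nonlocalEnergy]
  · refine lintegral_mono fun x => ?_
    rw [← compl_closedBall_zero, lintegral_add_compl _ measurableSet_closedBall]
    exact lintegral_mono fun h => Set.indicator_le_self _ _ _
  · exact (measurable_enorm_increment p hv).lintegral_prod_right'

theorem lintegral_inner_closedBall (hm : IsRadialLevy p m) (hp : 0 < p)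
    {e : EuclideanSpace ℝ (Fin d)} (he : ‖e‖ = 1) (hg : Measurable g) (τ : ℝ) :
    ∫⁻ h in Metric.closedBall 0 τ, (∫⁻ x in A, ‖inner ℝ (g x) h‖ₑ ^ p) ∂m =
      ENNReal.ofReal (sphereMean d p e) * (∫⁻ x in A, ‖g x‖ₑ ^ p) *
        ∫⁻ h in Metric.closedBall 0 τ, ‖h‖ₑ ^ p ∂m := by
  rw [lintegral_lintegral_swap]
  · simp_rw [hm.setLIntegral_enorm_inner_rpow hp he]
    rw [lintegral_const_mul, lintegral_mul_const _ (hg.enorm.pow_const p), mul_assoc]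
    exact (hg.enorm.pow_const p).mul_const _
  · refine Measurable.aemeasurable ?_
    exact (Measurable.inner (hg.comp measurable_snd) measurable_fst).enorm.pow_const p

omit [SFinite m] in
theorem lintegral_closedBall_le {f : EuclideanSpace ℝ (Fin d) → ℝ≥0∞} (hm : IsRadialLevy p m)
    (hp : 0 < p) {τ : ℝ} (hτ : τ ≤ 1) {η : ℝ≥0∞} (hf : ∀ h, ‖h‖ ≤ τ → f h ≤ η * ‖h‖ₑ ^ p) :
    ∫⁻ h in Metric.closedBall 0 τ, f h ∂m ≤ η := by
  calc ∫⁻ h in Metric.closedBall 0 τ, f h ∂m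
      ≤ ∫⁻ h in Metric.closedBall 0 τ, η * ‖h‖ₑ ^ p ∂m :=
        setLIntegral_mono' measurableSet_closedBall
          fun h hh => hf h (by simpa using hh)
    _ = η * ∫⁻ h in Metric.closedBall 0 τ, ‖h‖ₑ ^ p ∂m :=
        lintegral_const_mul _ (measurable_enorm.pow_const p)
    _ ≤ η * 1 := by gcongr; exact hm.setLIntegral_closedBall_le_one hp hτ
    _ = η := mul_one _

theorem measurable_inner_prod (hg : Measurable g) (p : ℝ) :
    Measurable fun q : EuclideanSpace ℝ (Fin d) × EuclideanSpace ℝ (Fin d) =>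
      ‖inner ℝ (g q.2) q.1‖ₑ ^ p :=
  (Measurable.inner (hg.comp measurable_snd) measurable_fst).enorm.pow_const p

theorem measurable_remainder (hv : Measurable v) (hg : Measurable g) (p : ℝ) :
    Measurable fun q : EuclideanSpace ℝ (Fin d) × EuclideanSpace ℝ (Fin d) =>
      ‖v (q.2 + q.1) - v q.2 - inner ℝ (g q.2) q.1‖ₑ ^ p :=
  (((hv.comp (measurable_snd.add measurable_fst)).sub (hv.comp measurable_snd)).sub
    (Measurable.inner (hg.comp measurable_snd) measurable_fst)).enorm.pow_const p

theorem lintegral_add_rpow_le {f₁ f₂ f₃ : EuclideanSpace ℝ (Fin d) × EuclideanSpace ℝ (Fin d) → ℝ≥0∞}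
    {μ₁ μ₂ : Measure (EuclideanSpace ℝ (Fin d))} [SFinite μ₂]
    {θ C : ℝ≥0∞} (h : ∀ q, f₁ q ≤ θ * f₂ q + C * f₃ q) (h₂ : Measurable f₂) (h₃ : Measurable f₃) :
    ∫⁻ h, ∫⁻ x, f₁ (h, x) ∂μ₂ ∂μ₁ ≤
      θ * ∫⁻ h, ∫⁻ x, f₂ (h, x) ∂μ₂ ∂μ₁ + C * ∫⁻ h, ∫⁻ x, f₃ (h, x) ∂μ₂ ∂μ₁ := by
  calc ∫⁻ h, ∫⁻ x, f₁ (h, x) ∂μ₂ ∂μ₁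
      ≤ ∫⁻ h, ∫⁻ x, (θ * f₂ (h, x) + C * f₃ (h, x)) ∂μ₂ ∂μ₁ :=
        lintegral_mono fun _ => lintegral_mono fun _ => h _
    _ = _ := by
        rw [← lintegral_const_mul _ h₂.lintegral_prod_right',
          ← lintegral_const_mul _ h₃.lintegral_prod_right', ← lintegral_add_left]
        · refine lintegral_congr fun a => ?_
          have h2a : Measurable fun x => f₂ (a, x) := h₂.comp measurable_prodMk_left
          have h3a : Measurable fun x => f₃ (a, x) := h₃.comp measurable_prodMk_left
          rw [lintegral_add_left (h2a.const_mul θ), lintegral_const_mul _ h2a,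
            lintegral_const_mul _ h3a]
        · exact h₂.lintegral_prod_right'.const_mul θ

/-- Increment equals linear term plus remainder. The linear term is computed exactly by rotation
invariance, and a remainder controlled by `η |h|^p` costs at most `C η`, because the near mass of
`|h|^p` is at most 1. -/
theorem shortEnergy_le_of_remainder (hm : IsRadialLevy p m) (hp : 0 < p)
    {e : EuclideanSpace ℝ (Fin d)} (he : ‖e‖ = 1) (hv : Measurable v) (hg : Measurable g)
    {τ : ℝ} (hτ : τ ≤ 1) {η θ C : ℝ≥0∞} (hC : ∀ a b : ℝ≥0∞, (a + b) ^ p ≤ θ * a ^ p + C * b ^ p)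
    (hη : ∀ h, ‖h‖ ≤ τ → ∫⁻ x in A, ‖v (x + h) - v x - inner ℝ (g x) h‖ₑ ^ p ≤ η * ‖h‖ₑ ^ p) :
    shortEnergy p m τ A v ≤
      θ * (ENNReal.ofReal (sphereMean d p e) * ∫⁻ x in A, ‖g x‖ₑ ^ p) + C * η := by
  have h := lintegral_add_rpow_le (μ₁ := m.restrict (Metric.closedBall 0 τ))
    (μ₂ := volume.restrict A)
    (f₁ := fun q => ‖v (q.2 + q.1) - v q.2‖ₑ ^ p) (θ := θ) (C := C) (fun q => ?_)
    (measurable_inner_prod hg p) (measurable_remainder hv hg p)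
  · refine h.trans (add_le_add ?_ ?_)
    · gcongr
      rw [lintegral_inner_closedBall hm hp he hg τ]
      exact mul_le_of_le_one_right' (hm.setLIntegral_closedBall_le_one hp hτ)
    · gcongr
      exact lintegral_closedBall_le hm hp hτ hη
  · refine le_trans ?_ (hC _ _)
    gcongr
    refine le_trans (le_of_eq ?_) (enorm_add_le _ _)
    congr 1; ring

/-- The same splitting with the linear term written as increment minus remainder. The near mass
stays on the left: it may be less than 1 and reaches 1 only in the limit. -/
theorem le_shortEnergy_of_remainder (hm : IsRadialLevy p m) (hp : 0 < p)
    {e : EuclideanSpace ℝ (Fin d)} (he : ‖e‖ = 1) (hv : Measurable v) (hg : Measurable g)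
    {τ : ℝ} (hτ : τ ≤ 1) {η θ C : ℝ≥0∞} (hC : ∀ a b : ℝ≥0∞, (a + b) ^ p ≤ θ * a ^ p + C * b ^ p)
    (hη : ∀ h, ‖h‖ ≤ τ → ∫⁻ x in A, ‖v (x + h) - v x - inner ℝ (g x) h‖ₑ ^ p ≤ η * ‖h‖ₑ ^ p) :
    ENNReal.ofReal (sphereMean d p e) * (∫⁻ x in A, ‖g x‖ₑ ^ p) *
        ∫⁻ h in Metric.closedBall 0 τ, ‖h‖ₑ ^ p ∂m ≤
      θ * shortEnergy p m τ A v + C * η := by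
  have h := lintegral_add_rpow_le (μ₁ := m.restrict (Metric.closedBall 0 τ))
    (μ₂ := volume.restrict A)
    (f₁ := fun q => ‖inner ℝ (g q.2) q.1‖ₑ ^ p) (θ := θ) (C := C) (fun q => ?_)
    ((measurable_enorm_increment p hv).comp measurable_swap) (measurable_remainder hv hg p)
  · dsimp only [Function.comp, Prod.swap] at h
    rw [lintegral_inner_closedBall hm hp he hg τ] at h
    refine h.trans (add_le_add le_rfl ?_)
    gcongr
    exact lintegral_closedBall_le hm hp hτ hη
  · refine le_trans ?_ (hC _ _)
    gcongr
    refine le_trans (le_of_eq ?_) enorm_sub_le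
    congr 1; simp

end Energy

/-- Substitute `y = x + h` and use that the kernel is even. Since the indicator of `Ω` discards `v`
outside `Ω`, any measurable `v` equal to `u` almost everywhere in `Ω` will do. -/
theorem nonlocalMeasure_apply {d : ℕ} {p : ℝ} {ν : EuclideanSpace ℝ (Fin d) → ℝ≥0∞}
    (hν : AEMeasurable ν volume) (hrad : ∀ h, ν (-h) = ν h)
    {Ω A : Set (EuclideanSpace ℝ (Fin d))} (hΩ : MeasurableSet Ω) (hA : MeasurableSet A)
    (hAΩ : A ⊆ Ω) {u v : EuclideanSpace ℝ (Fin d) → ℝ} (hv : Measurable v)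
    (huv : u =ᵐ[volume.restrict Ω] v) :
    nonlocalMeasure p Ω ν u A = nonlocalEnergy p (volume.withDensity ν) Ω A v := by
  rw [nonlocalMeasure, withDensity_apply _ hA, Measure.restrict_restrict hA,
    Set.inter_eq_left.2 hAΩ, nonlocalEnergy]
  refine lintegral_congr_ae ?_
  filter_upwards [ae_restrict_of_ae_restrict_of_subset hAΩ huv] with x hx
  have hmeas : Measurable (Ω.indicator fun y => ‖v y - v x‖ₑ ^ p) :=
    ((hv.sub_const (v x)).enorm.pow_const p).indicator hΩ
  calc ∫⁻ y in Ω, ‖u x - u y‖ₑ ^ p * ν (x - y)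
      = ∫⁻ y in Ω, ‖v y - v x‖ₑ ^ p * ν (y - x) := by
        refine lintegral_congr_ae ?_
        filter_upwards [huv] with y hy
        rw [hx, hy, ← hrad (x - y), neg_sub, ← enorm_neg, neg_sub]
    _ = ∫⁻ y, Ω.indicator (fun y => ‖v y - v x‖ₑ ^ p) y * ν (y - x) := by
        rw [← lintegral_indicator hΩ]
        refine lintegral_congr fun y => ?_
        by_cases hy : y ∈ Ω <;> simp [hy]
    _ = ∫⁻ h, Ω.indicator (fun y => ‖v y - v x‖ₑ ^ p) (x + h) * ν h := by
        rw [← lintegral_add_left_eq_self _ x]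
        simp
    _ = _ := by
        exact ((lintegral_withDensity_eq_lintegral_mul₀ hν
          (hmeas.comp (measurable_const_add x)).aemeasurable).trans
            (lintegral_congr fun h => mul_comm _ _)).symm

/-! ### Mollification -/

section Mollify

variable {d : ℕ} {F : Type*} [NormedAddCommGroup F] [NormedSpace ℝ F]

/-- The mollification of `f` by a normalised bump function. -/
noncomputable def mollify (b : ContDiffBump (0 : EuclideanSpace ℝ (Fin d)))
    (f : EuclideanSpace ℝ (Fin d) → F) : EuclideanSpace ℝ (Fin d) → F :=
  convolution (b.normed volume) f (ContinuousLinearMap.lsmul ℝ ℝ) volume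

/-- The probability measure whose density is a normalised bump function. -/
noncomputable def bumpMeasure (b : ContDiffBump (0 : EuclideanSpace ℝ (Fin d))) :
    Measure (EuclideanSpace ℝ (Fin d)) :=
  volume.withDensity fun t => ENNReal.ofReal (b.normed volume t)

/-- A sequence of bump functions with supports shrinking to the origin. -/
noncomputable def bumpSeq (d : ℕ) (n : ℕ) : ContDiffBump (0 : EuclideanSpace ℝ (Fin d)) where
  rIn := 1 / (2 * ((n : ℝ) + 1))
  rOut := 1 / ((n : ℝ) + 1)
  rIn_pos := by positivity
  rIn_lt_rOut := by
    apply one_div_lt_one_div_of_lt <;> have : (0 : ℝ) ≤ n := n.cast_nonneg <;> linarith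

theorem tendsto_bumpSeq_rOut (d : ℕ) : Tendsto (fun n => (bumpSeq d n).rOut) atTop (𝓝 0) :=
  tendsto_one_div_add_atTop_nhds_zero_nat

theorem ae_tendsto_mollify_bumpSeq [CompleteSpace F] {f : EuclideanSpace ℝ (Fin d) → F}
    (hf : LocallyIntegrable f volume) :
    ∀ᵐ x, Tendsto (fun n => mollify (bumpSeq d n) f x) atTop (𝓝 (f x)) := by
  -- Lebesgue differentiation along bumps requires a bounded ratio of outer to inner radius; for
  -- `bumpSeq` the ratio is exactly 2.
  refine ContDiffBump.ae_convolution_tendsto_right_of_locallyIntegrable (K := 2)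
    (tendsto_bumpSeq_rOut d) (Eventually.of_forall fun n => le_of_eq ?_) hf
  simp only [bumpSeq]
  field_simp

variable (b : ContDiffBump (0 : EuclideanSpace ℝ (Fin d))) {f : EuclideanSpace ℝ (Fin d) → F}

theorem mollify_apply (f : EuclideanSpace ℝ (Fin d) → F) (x : EuclideanSpace ℝ (Fin d)) :
    mollify b f x = ∫ t, b.normed volume t • f (x - t) := rfl

theorem mollify_apply_swap (f : EuclideanSpace ℝ (Fin d) → F) (x : EuclideanSpace ℝ (Fin d)) :
    mollify b f x = ∫ y, b.normed volume (x - y) • f y :=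
  convolution_eq_swap _

theorem continuous_normed_bump : Continuous (b.normed volume) :=
  (b.contDiff_normed (n := 0)).continuous

instance : IsProbabilityMeasure (bumpMeasure b) where
  measure_univ := by
    rw [bumpMeasure, withDensity_apply _ MeasurableSet.univ, Measure.restrict_univ,
      ← ofReal_integral_eq_lintegral_ofReal b.integrable_normed
        (Eventually.of_forall b.nonneg_normed), b.integral_normed, ENNReal.ofReal_one]

theorem ae_bumpMeasure_norm_lt : ∀ᵐ t ∂(bumpMeasure b), ‖t‖ < b.rOut := by
  rw [bumpMeasure, ae_withDensity_iff (continuous_normed_bump b).measurable.ennreal_ofReal]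
  refine Eventually.of_forall fun t ht => ?_
  have : t ∈ Function.support (b.normed volume) := by
    intro h0; simp [h0] at ht
  rw [b.support_normed_eq] at this
  simpa using this

theorem enorm_integral_normed_smul_le {f : EuclideanSpace ℝ (Fin d) → F}
    (hf : AEStronglyMeasurable f volume) :
    ‖∫ t, b.normed volume t • f t‖ₑ ≤ ∫⁻ t, ‖f t‖ₑ ∂(bumpMeasure b) := by
  refine (enorm_integral_le_lintegral_enorm _).trans (le_of_eq ?_)
  rw [bumpMeasure, lintegral_withDensity_eq_lintegral_mul₀
    (continuous_normed_bump b).measurable.ennreal_ofReal.aemeasurable hf.enorm]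
  refine lintegral_congr fun t => ?_
  rw [enorm_smul, Pi.mul_apply, Real.enorm_of_nonneg (b.nonneg_normed t)]

theorem integrable_normed_smul_comp_sub (hf : LocallyIntegrable f volume)
    (x : EuclideanSpace ℝ (Fin d)) :
    Integrable (fun t => b.normed volume t • f (x - t)) volume :=
  b.hasCompactSupport_normed.convolutionExists_left (ContinuousLinearMap.lsmul ℝ ℝ)
    (continuous_normed_bump b) hf x

omit [NormedSpace ℝ F] in
theorem aestronglyMeasurable_comp_sub_left {f : EuclideanSpace ℝ (Fin d) → F}
    (hf : AEStronglyMeasurable f volume)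
    (x : EuclideanSpace ℝ (Fin d)) : AEStronglyMeasurable (fun t => f (x - t)) volume :=
  hf.comp_quasiMeasurePreserving (quasiMeasurePreserving_sub_left_of_right_invariant volume x)

theorem enorm_mollify_add_sub_le (hf : LocallyIntegrable f volume)
    (x h : EuclideanSpace ℝ (Fin d)) :
    ‖mollify b f (x + h) - mollify b f x‖ₑ ≤
      ∫⁻ t, ‖f (x + h - t) - f (x - t)‖ₑ ∂(bumpMeasure b) := by
  rw [mollify_apply, mollify_apply, ← integral_sub (integrable_normed_smul_comp_sub b hf _)
    (integrable_normed_smul_comp_sub b hf _)]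
  simp_rw [← smul_sub]
  exact enorm_integral_normed_smul_le b
    ((aestronglyMeasurable_comp_sub_left hf.aestronglyMeasurable _).sub
      (aestronglyMeasurable_comp_sub_left hf.aestronglyMeasurable _))

theorem contDiff_mollify [CompleteSpace F] (hf : LocallyIntegrable f volume) :
    ContDiff ℝ ∞ (mollify b f) :=
  b.hasCompactSupport_normed.contDiff_convolution_left _ b.contDiff_normed hf

theorem fderiv_mollify_apply [CompleteSpace F] (hf : LocallyIntegrable f volume)
    (x k : EuclideanSpace ℝ (Fin d)) :
    fderiv ℝ (mollify b f) x k = ∫ y, fderiv ℝ (b.normed volume) (x - y) k • f y := by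
  have h := (b.hasCompactSupport_normed.hasFDerivAt_convolution_left
    (ContinuousLinearMap.lsmul ℝ ℝ) (b.contDiff_normed (n := 1) (μ := volume)) hf x).fderiv
  have hint := (b.hasCompactSupport_normed (μ := volume)).fderiv (𝕜 := ℝ)
    |>.convolutionExists_left
    ((ContinuousLinearMap.lsmul ℝ ℝ).precompL (EuclideanSpace ℝ (Fin d)) :
      (EuclideanSpace ℝ (Fin d) →L[ℝ] ℝ) →L[ℝ] F →L[ℝ] (EuclideanSpace ℝ (Fin d) →L[ℝ] F))
    ((b.contDiff_normed (n := 1) (μ := volume)).continuous_fderiv one_ne_zero) hf x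
  change fderiv ℝ (convolution _ _ _ _) x k = _
  rw [h, convolution_def, ContinuousLinearMap.integral_apply hint]
  rw [← integral_sub_left_eq_self _ volume x]
  simp

theorem fderiv_normed_neg (z k : EuclideanSpace ℝ (Fin d)) :
    fderiv ℝ (b.normed volume) (-z) k = -fderiv ℝ (b.normed volume) z k := by
  have h : (fun z => b.normed volume (-z)) = b.normed volume := by
    ext z; exact b.normed_neg z
  have h1 : HasFDerivAt (fun y : EuclideanSpace ℝ (Fin d) => -y) (-ContinuousLinearMap.id ℝ _) z :=
    (hasFDerivAt_id z).neg
  have h2 := (((b.contDiff_normed (n := 1) (μ := volume)).differentiable one_ne_zero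
    (-z)).hasFDerivAt.comp z h1).fderiv
  change fderiv ℝ (fun z => b.normed volume (-z)) z = _ at h2
  rw [h] at h2
  rw [h2]
  simp

theorem exists_bound_fderiv_normed :
    ∃ C : ℝ, ∀ z, ‖fderiv ℝ (b.normed volume) z‖ ≤ C := by
  obtain ⟨C, hC⟩ := ((b.contDiff_normed (n := 1) (μ := volume)).continuous_fderiv
    one_ne_zero).bounded_above_of_compact_support
      ((b.hasCompactSupport_normed (μ := volume)).fderiv (𝕜 := ℝ))
  exact ⟨C, hC⟩

theorem continuousLinearMap_apply_eq_sum (A : EuclideanSpace ℝ (Fin d) →L[ℝ] ℝ)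
    (k : EuclideanSpace ℝ (Fin d)) : A k = ∑ i, A (EuclideanSpace.single i 1) * k i := by
  conv_lhs => rw [← (EuclideanSpace.basisFun (Fin d) ℝ).sum_repr k]
  simp [mul_comm]

/-- All derivatives fall on the bump, so `φ` need only be continuous. -/
theorem divergence_mollify {φ : EuclideanSpace ℝ (Fin d) → EuclideanSpace ℝ (Fin d)}
    (hφ : Continuous φ) (hφc : HasCompactSupport φ) (y : EuclideanSpace ℝ (Fin d)) :
    divergence (mollify b φ) y = ∫ x, fderiv ℝ (b.normed volume) (y - x) (φ x) := by
  have hcont : Continuous (fderiv ℝ (b.normed volume)) :=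
    (b.contDiff_normed (n := 1) (μ := volume)).continuous_fderiv one_ne_zero
  have hint : ∀ k, Integrable (fun x => fderiv ℝ (b.normed volume) (y - x) k • φ x) := by
    intro k
    refine Continuous.integrable_of_hasCompactSupport (by fun_prop) ?_
    exact hφc.smul_left (f := fun x => fderiv ℝ (b.normed volume) (y - x) k)
  rw [divergence]
  simp_rw [fderiv_mollify_apply b (hφ.integrable_of_hasCompactSupport hφc).locallyIntegrable]
  have hcoord : ∀ i : Fin d, (∫ x, fderiv ℝ (b.normed volume) (y - x)
      (EuclideanSpace.single i 1) • φ x) i =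
      ∫ x, fderiv ℝ (b.normed volume) (y - x) (EuclideanSpace.single i 1) * φ x i := by
    intro i
    have := (EuclideanSpace.proj (𝕜 := ℝ) i : EuclideanSpace ℝ (Fin d) →L[ℝ] ℝ).integral_comp_comm
      (hint (EuclideanSpace.single i 1))
    simpa using this.symm
  simp_rw [hcoord]
  rw [← integral_finsetSum]
  · simp_rw [← continuousLinearMap_apply_eq_sum]
  · intro i _
    have := (EuclideanSpace.proj (𝕜 := ℝ) i : EuclideanSpace ℝ (Fin d) →L[ℝ] ℝ).integrable_comp
      (hint (EuclideanSpace.single i 1))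
    simpa using this

/-- Fubini, with the oddness of the derivative of the even bump supplying the sign. The identity
assumes nothing about derivatives of `v`: it turns the variation of `v` into classical gradients of
its mollifications. -/
theorem integral_mul_divergence_mollify {v : EuclideanSpace ℝ (Fin d) → ℝ}
    (hv : Integrable v) {φ : EuclideanSpace ℝ (Fin d) → EuclideanSpace ℝ (Fin d)}
    (hφ : Continuous φ) (hφc : HasCompactSupport φ) :
    ∫ y, v y * divergence (mollify b φ) y = -∫ x, fderiv ℝ (mollify b v) x (φ x) := by
  have hcont : Continuous (fderiv ℝ (b.normed volume)) :=
    (b.contDiff_normed (n := 1) (μ := volume)).continuous_fderiv one_ne_zero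
  obtain ⟨C, hC⟩ := exists_bound_fderiv_normed b
  have hint : Integrable (fun q : EuclideanSpace ℝ (Fin d) × EuclideanSpace ℝ (Fin d) =>
      v q.1 * fderiv ℝ (b.normed volume) (q.1 - q.2) (φ q.2)) (volume.prod volume) := by
    have h1 : Integrable (fun q : EuclideanSpace ℝ (Fin d) × EuclideanSpace ℝ (Fin d) =>
        v q.1 * (C * ‖φ q.2‖)) (volume.prod volume) :=
      hv.mul_prod ((hφ.integrable_of_hasCompactSupport hφc).norm.const_mul C)
    refine h1.mono (hv.aestronglyMeasurable.comp_fst.mul ?_) (Eventually.of_forall fun q => ?_)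
    · have : Continuous fun q : EuclideanSpace ℝ (Fin d) × EuclideanSpace ℝ (Fin d) =>
        fderiv ℝ (b.normed volume) (q.1 - q.2) (φ q.2) := by fun_prop
      exact this.aestronglyMeasurable
    · rw [norm_mul, norm_mul]
      gcongr
      refine (ContinuousLinearMap.le_opNorm _ _).trans ((mul_le_mul_of_nonneg_right (hC _)
        (norm_nonneg _)).trans (le_abs_self _))
  simp_rw [divergence_mollify b hφ hφc, fderiv_mollify_apply b hv.locallyIntegrable,
    ← integral_const_mul]
  rw [integral_integral_swap hint, ← integral_neg]
  refine integral_congr_ae (Eventually.of_forall fun x => ?_)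
  dsimp only
  rw [← integral_neg]
  refine integral_congr_ae (Eventually.of_forall fun y => ?_)
  dsimp only
  rw [← neg_sub x y, fderiv_normed_neg, smul_eq_mul]
  ring

/-- The bump centred at `x` is itself an admissible test function, its support being contained in
the closed ball inside `Ω`. -/
theorem fderiv_mollify_of_hasWeakGradient {Ω : Set (EuclideanSpace ℝ (Fin d))}
    {u v : EuclideanSpace ℝ (Fin d) → ℝ}
    {g G : EuclideanSpace ℝ (Fin d) → EuclideanSpace ℝ (Fin d)} (hg : HasWeakGradient Ω u g)
    (huv : u =ᵐ[volume.restrict Ω] v) (hgG : g =ᵐ[volume.restrict Ω] G)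
    (hv : LocallyIntegrable v) (hG : LocallyIntegrable G)
    {x : EuclideanSpace ℝ (Fin d)} (hx : Metric.closedBall x b.rOut ⊆ Ω)
    (k : EuclideanSpace ℝ (Fin d)) :
    fderiv ℝ (mollify b v) x k = inner ℝ (mollify b G x) k := by
  set φ : EuclideanSpace ℝ (Fin d) → ℝ := fun y => b.normed volume (x - y) with hφdef
  have hφ : ContDiff ℝ ∞ φ := b.contDiff_normed.comp (contDiff_const.sub contDiff_id)
  have hzero : ∀ y, y ∉ Metric.ball x b.rOut → φ y = 0 := by
    intro y hy
    by_contra h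
    have : x - y ∈ Function.support (b.normed volume) := h
    rw [b.support_normed_eq, mem_ball_zero_iff] at this
    exact hy (by rwa [Metric.mem_ball, dist_comm, dist_eq_norm])
  have hts : tsupport φ ⊆ Metric.closedBall x b.rOut := by
    refine closure_minimal (fun y hy => ?_) Metric.isClosed_closedBall
    by_contra h
    exact hy (hzero y fun h' => h (Metric.ball_subset_closedBall h'))
  have hφc : HasCompactSupport φ :=
    (isCompact_closedBall x b.rOut).of_isClosed_subset (isClosed_tsupport _) hts
  have hφ' : ∀ y k, fderiv ℝ φ y k = -fderiv ℝ (b.normed volume) (x - y) k := by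
    intro y k
    have h1 : HasFDerivAt (fun y => x - y) (-ContinuousLinearMap.id ℝ _) y :=
      (hasFDerivAt_id y).const_sub x
    have h2 := ((b.contDiff_normed (n := 1) (μ := volume)).differentiable one_ne_zero
      (x - y)).hasFDerivAt.comp y h1
    have : φ = b.normed volume ∘ fun y => x - y := rfl
    rw [this, h2.fderiv]
    simp
  have key : ∀ i, fderiv ℝ (mollify b v) x (EuclideanSpace.single i 1) = mollify b G x i := by
    intro i
    have h := hg φ hφ hφc (hts.trans hx) i
    have hl : ∫ y in Ω, u y * fderiv ℝ φ y (EuclideanSpace.single i 1) =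
        ∫ y, v y * fderiv ℝ φ y (EuclideanSpace.single i 1) := by
      rw [integral_congr_ae (g := fun y => v y * fderiv ℝ φ y (EuclideanSpace.single i 1))
        (huv.mono fun y hy => by simp [hy])]
      refine setIntegral_eq_integral_of_forall_compl_eq_zero fun y hy => ?_
      have : fderiv ℝ φ y = 0 := by
        by_contra hne
        exact hy (hx (hts (support_fderiv_subset ℝ hne)))
      simp [this]
    have hr : ∫ y in Ω, g y i * φ y = ∫ y, G y i * φ y := by
      rw [integral_congr_ae (g := fun y => G y i * φ y) (hgG.mono fun y hy => by simp [hy])]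
      refine setIntegral_eq_integral_of_forall_compl_eq_zero fun y hy => ?_
      rw [hzero y fun h' => hy (hx (Metric.ball_subset_closedBall h')), mul_zero]
    rw [hl, hr] at h
    rw [fderiv_mollify_apply b hv, mollify_apply_swap]
    have hint : Integrable fun y => b.normed volume (x - y) • G y := by
      have := (integrable_normed_smul_comp_sub b hG x).comp_sub_left x
      simpa using this
    have h3 := (EuclideanSpace.proj (𝕜 := ℝ) i : EuclideanSpace ℝ (Fin d) →L[ℝ] ℝ).integral_comp_comm
      hint
    simp only [EuclideanSpace.coe_proj, PiLp.smul_apply, smul_eq_mul] at h3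
    rw [← h3, ← neg_inj, ← integral_neg]
    refine (integral_congr_ae (Eventually.of_forall fun y => ?_)).trans (h.trans
      (congrArg Neg.neg (integral_congr_ae (Eventually.of_forall fun y => ?_))))
    · rw [hφ', smul_eq_mul]; ring
    · simp only [φ]; ring
  rw [continuousLinearMap_apply_eq_sum]
  simp_rw [key]
  simp [PiLp.inner_apply, mul_comm]

end Mollify

/-! ### Taylor remainders in `L^p` -/

section Remainder

variable {d : ℕ} {F : Type*} [NormedAddCommGroup F]

/-- The fundamental theorem of calculus along the segment. The free constant `c` is the linear term
in remainder estimates and zero in plain increment estimates. -/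
theorem enorm_increment_sub_le {v : EuclideanSpace ℝ (Fin d) → ℝ} (hv : ContDiff ℝ 1 v)
    (x h : EuclideanSpace ℝ (Fin d)) (c : ℝ) :
    ‖v (x + h) - v x - c‖ₑ ≤
      ∫⁻ t in Set.Ioc (0 : ℝ) 1, ‖fderiv ℝ v (x + t • h) h - c‖ₑ := by
  have hcont : Continuous fun t : ℝ => fderiv ℝ v (x + t • h) h := by
    have := hv.continuous_fderiv one_ne_zero
    fun_prop
  have hderiv : ∀ t : ℝ, HasDerivAt (fun t : ℝ => v (x + t • h)) (fderiv ℝ v (x + t • h) h) t := by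
    intro t
    have h1 : HasDerivAt (fun t : ℝ => x + t • h) h t := by
      simpa using ((hasDerivAt_id t).smul_const h).const_add x
    exact ((hv.differentiable one_ne_zero (x + t • h)).hasFDerivAt).comp_hasDerivAt t h1
  have hint := intervalIntegral.integral_eq_sub_of_hasDerivAt (a := 0) (b := 1)
    (fun t _ => hderiv t) (hcont.intervalIntegrable 0 1)
  have h2 : v (x + h) - v x - c = ∫ t in (0 : ℝ)..1, (fderiv ℝ v (x + t • h) h - c) := by
    rw [intervalIntegral.integral_sub (hcont.intervalIntegrable 0 1) (by simp), hint]
    simp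
  rw [h2, intervalIntegral.integral_of_le zero_le_one]
  exact enorm_integral_le_lintegral_enorm _

instance : IsProbabilityMeasure ((volume : Measure ℝ).restrict (Set.Ioc 0 1)) :=
  ⟨by simp⟩

/-- Continuity of translations in `L^p` for finite exponents, read off from the continuity of
composition with measure preserving maps. -/
theorem exists_forall_lintegral_translate_le {p : ℝ} (hp : 1 ≤ p)
    {f : EuclideanSpace ℝ (Fin d) → F} (hf : MemLp f (ENNReal.ofReal p) volume)
    {η : ℝ≥0∞} (hη : 0 < η) :
    ∃ τ > 0, ∀ k : EuclideanSpace ℝ (Fin d), ‖k‖ ≤ τ →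
      ∫⁻ x, ‖f (x + k) - f x‖ₑ ^ p ≤ η := by
  have hp0 : 0 < p := by linarith
  have : Fact (1 ≤ ENNReal.ofReal p) := ⟨by simpa using hp⟩
  let T : EuclideanSpace ℝ (Fin d) → C(EuclideanSpace ℝ (Fin d), EuclideanSpace ℝ (Fin d)) :=
    (ContinuousMap.mk (fun q : EuclideanSpace ℝ (Fin d) × EuclideanSpace ℝ (Fin d) => q.2 + q.1)
      (by fun_prop)).curry
  have hT : Continuous T := ContinuousMap.continuous _
  have hpres : ∀ k, MeasurePreserving (T k) volume volume := fun k =>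
    measurePreserving_add_right volume k
  have hlim := Filter.Tendsto.compMeasurePreservingLp (l := 𝓝 (0 : EuclideanSpace ℝ (Fin d)))
    (tendsto_const_nhds (x := hf.toLp f)) (hT.tendsto 0) hpres (hpres 0) ENNReal.ofReal_ne_top
  rw [EMetric.tendsto_nhds] at hlim
  have hηp : 0 < η ^ (1 / p) := by
    rcases eq_or_ne η ⊤ with rfl | ht
    · rw [ENNReal.top_rpow_of_pos (by positivity)]; simp
    · exact ENNReal.rpow_pos hη ht
  obtain ⟨τ, hτ, hball⟩ := Metric.eventually_nhds_iff_ball.1 (hlim _ hηp)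
  refine ⟨τ / 2, by positivity, fun k hk => ?_⟩
  have h1 := hball k (by rw [mem_ball_zero_iff]; linarith)
  have h0 : Lp.compMeasurePreserving (T 0) (hpres 0) (hf.toLp f) = hf.toLp f := by
    rw [Lp.toLp_compMeasurePreserving]
    congr 1
    ext x; simp [T]
  rw [h0, Lp.toLp_compMeasurePreserving, Lp.edist_toLp_toLp,
    eLpNorm_eq_lintegral_rpow_enorm_toReal (by simpa using hp0) ENNReal.ofReal_ne_top,
    ENNReal.toReal_ofReal hp0.le] at h1
  have h2 := ENNReal.rpow_le_rpow h1.le hp0.le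
  rw [← ENNReal.rpow_mul, ← ENNReal.rpow_mul, one_div_mul_cancel hp0.ne', ENNReal.rpow_one,
    ENNReal.rpow_one] at h2
  exact h2

theorem memLp_locallyIntegrable {p : ℝ} (hp : 1 ≤ p)
    {f : EuclideanSpace ℝ (Fin d) → F} (hf : MemLp f (ENNReal.ofReal p) volume) :
    LocallyIntegrable f volume :=
  hf.locallyIntegrable (by simpa using hp)

variable [NormedSpace ℝ F]

/-- An increment of the mollification is an average of translated increments; apply Jensen and
Tonelli. The translates are kept inside the integral over `A` so that both global and localized
bounds can be derived. -/
theorem lintegral_enorm_mollify_increment_rpow_le {p : ℝ} (hp : 1 ≤ p)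
    (b : ContDiffBump (0 : EuclideanSpace ℝ (Fin d)))
    {f : EuclideanSpace ℝ (Fin d) → F} (hfm : StronglyMeasurable f)
    (hf : LocallyIntegrable f volume) (A : Set (EuclideanSpace ℝ (Fin d)))
    (h : EuclideanSpace ℝ (Fin d)) :
    ∫⁻ x in A, ‖mollify b f (x + h) - mollify b f x‖ₑ ^ p ≤
      ∫⁻ t, (∫⁻ x in A, ‖f (x + h - t) - f (x - t)‖ₑ ^ p) ∂(bumpMeasure b) := by
  have hmeas : Measurable fun q : EuclideanSpace ℝ (Fin d) × EuclideanSpace ℝ (Fin d) =>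
      ‖f (q.1 + h - q.2) - f (q.1 - q.2)‖ₑ :=
    ((hfm.comp_measurable (by fun_prop)).sub (hfm.comp_measurable (by fun_prop))).enorm
  rw [lintegral_lintegral_swap]
  · refine lintegral_mono fun x => ?_
    calc ‖mollify b f (x + h) - mollify b f x‖ₑ ^ p
        ≤ (∫⁻ t, ‖f (x + h - t) - f (x - t)‖ₑ ∂(bumpMeasure b)) ^ p := by
          gcongr
          exact enorm_mollify_add_sub_le b hf x h
      _ ≤ ∫⁻ t, ‖f (x + h - t) - f (x - t)‖ₑ ^ p ∂(bumpMeasure b) :=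
          lintegral_rpow_le_lintegral_rpow hp
            (hmeas.comp measurable_prodMk_left).aemeasurable
  · exact ((hmeas.comp measurable_swap).pow_const p).aemeasurable

theorem lintegral_mollify_translate_le {p : ℝ} (hp : 1 ≤ p)
    (b : ContDiffBump (0 : EuclideanSpace ℝ (Fin d)))
    {f : EuclideanSpace ℝ (Fin d) → F} (hfm : StronglyMeasurable f)
    (hf : LocallyIntegrable f volume) (A : Set (EuclideanSpace ℝ (Fin d)))
    (h : EuclideanSpace ℝ (Fin d)) :
    ∫⁻ x in A, ‖mollify b f (x + h) - mollify b f x‖ₑ ^ p ≤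
      ∫⁻ x, ‖f (x + h) - f x‖ₑ ^ p := by
  refine (lintegral_enorm_mollify_increment_rpow_le hp b hfm hf A h).trans ?_
  calc ∫⁻ t, (∫⁻ x in A, ‖f (x + h - t) - f (x - t)‖ₑ ^ p) ∂(bumpMeasure b)
      ≤ ∫⁻ t, (∫⁻ x, ‖f (x + h) - f x‖ₑ ^ p) ∂(bumpMeasure b) := by
        refine lintegral_mono fun t => (setLIntegral_le_lintegral _ _).trans (le_of_eq ?_)
        rw [← lintegral_sub_right_eq_self (fun x => ‖f (x + h) - f x‖ₑ ^ p) t]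
        simp_rw [sub_add_eq_add_sub]
    _ = _ := by simp

/-- The remainder is the integral over `t ∈ (0,1]` of `(∇(x + th) - ∇(x))·h`. Cauchy–Schwarz and
Jensen in `t` reduce it, for each `t`, to the translation of `G` by `th`, which is no longer than
`h`. -/
theorem sobolev_remainder_mollify_le {p : ℝ} (hp : 1 ≤ p)
    (b : ContDiffBump (0 : EuclideanSpace ℝ (Fin d)))
    {v : EuclideanSpace ℝ (Fin d) → ℝ} {G : EuclideanSpace ℝ (Fin d) → EuclideanSpace ℝ (Fin d)}
    (hv : LocallyIntegrable v) (hGm : StronglyMeasurable G)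
    (hG : LocallyIntegrable G) {A : Set (EuclideanSpace ℝ (Fin d))} (hA : MeasurableSet A)
    {h : EuclideanSpace ℝ (Fin d)}
    (hfd : ∀ x ∈ A, ∀ t ∈ Set.Ioc (0 : ℝ) 1, ∀ k,
      fderiv ℝ (mollify b v) (x + t • h) k = inner ℝ (mollify b G (x + t • h)) k)
    {S : ℝ≥0∞} (hS : ∀ k, ‖k‖ ≤ ‖h‖ → ∫⁻ x, ‖G (x + k) - G x‖ₑ ^ p ≤ S) :
    ∫⁻ x in A, ‖mollify b v (x + h) - mollify b v x - inner ℝ (mollify b G x) h‖ₑ ^ p ≤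
      S * ‖h‖ₑ ^ p := by
  have hp0 : 0 ≤ p := by linarith
  have hcG : Continuous (mollify b G) := (contDiff_mollify b hG).continuous
  have hcont : Continuous fun q : EuclideanSpace ℝ (Fin d) × ℝ =>
      ‖mollify b G (q.1 + q.2 • h) - mollify b G q.1‖ₑ ^ p := by
    refine ENNReal.continuous_rpow_const.comp (Continuous.enorm ?_)
    fun_prop
  calc ∫⁻ x in A, ‖mollify b v (x + h) - mollify b v x - inner ℝ (mollify b G x) h‖ₑ ^ p
      ≤ ∫⁻ x in A, ‖h‖ₑ ^ p * ∫⁻ t in Set.Ioc (0 : ℝ) 1,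
          ‖mollify b G (x + t • h) - mollify b G x‖ₑ ^ p := by
        refine setLIntegral_mono' hA fun x hx => ?_
        calc ‖mollify b v (x + h) - mollify b v x - inner ℝ (mollify b G x) h‖ₑ ^ p
            ≤ (∫⁻ t in Set.Ioc (0 : ℝ) 1, ‖fderiv ℝ (mollify b v) (x + t • h) h -
                inner ℝ (mollify b G x) h‖ₑ) ^ p := by
              gcongr
              exact enorm_increment_sub_le ((contDiff_mollify b hv).of_le (by simp)) x h _
          _ ≤ (∫⁻ t in Set.Ioc (0 : ℝ) 1, ‖h‖ₑ *
                ‖mollify b G (x + t • h) - mollify b G x‖ₑ) ^ p := by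
              gcongr 1
              refine setLIntegral_mono' measurableSet_Ioc fun t ht => ?_
              rw [hfd x hx t ht, ← inner_sub_left, mul_comm]
              simp only [← ofReal_norm]
              rw [← ENNReal.ofReal_mul (norm_nonneg _)]
              exact ENNReal.ofReal_le_ofReal (norm_inner_le_norm _ _)
          _ ≤ ∫⁻ t in Set.Ioc (0 : ℝ) 1, (‖h‖ₑ *
                ‖mollify b G (x + t • h) - mollify b G x‖ₑ) ^ p := by
              refine lintegral_rpow_le_lintegral_rpow hp (Continuous.aemeasurable ?_)
              exact ENNReal.continuous_const_mul enorm_ne_top |>.comp (by fun_prop)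
          _ = _ := by
              simp_rw [ENNReal.mul_rpow_of_nonneg _ _ hp0]
              rw [lintegral_const_mul]
              exact (hcont.comp (by fun_prop : Continuous fun t : ℝ => (x, t))).measurable
    _ = ‖h‖ₑ ^ p * ∫⁻ t in Set.Ioc (0 : ℝ) 1, ∫⁻ x in A,
          ‖mollify b G (x + t • h) - mollify b G x‖ₑ ^ p := by
        rw [lintegral_const_mul, lintegral_lintegral_swap hcont.measurable.aemeasurable]
        exact hcont.measurable.lintegral_prod_right'
    _ ≤ ‖h‖ₑ ^ p * ∫⁻ t in Set.Ioc (0 : ℝ) 1, S := by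
        refine mul_le_mul_right (setLIntegral_mono' (measurableSet_Ioc (a := (0 : ℝ)) (b := 1))
          fun t ht => ?_) _
        refine (lintegral_mollify_translate_le hp b hGm hG A _).trans (hS _ ?_)
        rw [norm_smul, Real.norm_of_nonneg ht.1.le]
        exact mul_le_of_le_one_left (norm_nonneg _) ht.2
    _ = S * ‖h‖ₑ ^ p := by simp [mul_comm]

/-- Let the bumps shrink and use Fatou. As soon as the outer radius is below `r - ‖h‖`, the weak
gradient may be mollified at every point of the segments starting in `A`, all within `Ω`. -/
theorem sobolev_remainder_le {p : ℝ} (hp : 1 ≤ p) {Ω : Set (EuclideanSpace ℝ (Fin d))}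
    {u v : EuclideanSpace ℝ (Fin d) → ℝ}
    {g G : EuclideanSpace ℝ (Fin d) → EuclideanSpace ℝ (Fin d)} (hg : HasWeakGradient Ω u g)
    (huv : u =ᵐ[volume.restrict Ω] v) (hgG : g =ᵐ[volume.restrict Ω] G)
    (hv : LocallyIntegrable v) (hGm : StronglyMeasurable G)
    (hG : LocallyIntegrable G) {A : Set (EuclideanSpace ℝ (Fin d))} (hA : MeasurableSet A)
    {r : ℝ} (hr : ∀ x ∈ A, Metric.closedBall x r ⊆ Ω) {h : EuclideanSpace ℝ (Fin d)}
    (hh : ‖h‖ < r) {S : ℝ≥0∞} (hS : ∀ k, ‖k‖ ≤ ‖h‖ → ∫⁻ x, ‖G (x + k) - G x‖ₑ ^ p ≤ S) :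
    ∫⁻ x in A, ‖v (x + h) - v x - inner ℝ (G x) h‖ₑ ^ p ≤ S * ‖h‖ₑ ^ p := by
  have hae := ae_tendsto_mollify_bumpSeq hv
  have hae' : ∀ᵐ x, Tendsto (fun n => mollify (bumpSeq d n) v (x + h)) atTop (𝓝 (v (x + h))) :=
    (measurePreserving_add_right volume h).quasiMeasurePreserving.ae hae
  have hlim : ∀ᵐ x ∂(volume.restrict A), Tendsto (fun n => ‖mollify (bumpSeq d n) v (x + h) -
      mollify (bumpSeq d n) v x - inner ℝ (mollify (bumpSeq d n) G x) h‖ₑ ^ p) atTop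
      (𝓝 (‖v (x + h) - v x - inner ℝ (G x) h‖ₑ ^ p)) := by
    refine ae_restrict_of_ae ?_
    filter_upwards [hae, hae', ae_tendsto_mollify_bumpSeq hG] with x h1 h2 h3
    exact ((h2.sub h1).sub (h3.inner tendsto_const_nhds)).enorm.ennrpow_const p
  have hbound : ∀ᶠ n in atTop, ∫⁻ x in A, ‖mollify (bumpSeq d n) v (x + h) -
      mollify (bumpSeq d n) v x - inner ℝ (mollify (bumpSeq d n) G x) h‖ₑ ^ p ≤ S * ‖h‖ₑ ^ p := by
    filter_upwards [(tendsto_bumpSeq_rOut d).eventually_lt_const (sub_pos.2 hh)] with n hn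
    refine sobolev_remainder_mollify_le hp _ hv hGm hG hA (fun x hx t ht k => ?_) hS
    refine fderiv_mollify_of_hasWeakGradient _ hg huv hgG hv hG ?_ k
    refine (Metric.closedBall_subset_closedBall' ?_).trans (hr x hx)
    have : ‖t • h‖ ≤ ‖h‖ := by
      rw [norm_smul, Real.norm_of_nonneg ht.1.le]
      exact mul_le_of_le_one_left (norm_nonneg _) ht.2
    rw [dist_eq_norm, add_sub_cancel_left]
    linarith
  calc ∫⁻ x in A, ‖v (x + h) - v x - inner ℝ (G x) h‖ₑ ^ p
      = ∫⁻ x in A, liminf (fun n => ‖mollify (bumpSeq d n) v (x + h) -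
          mollify (bumpSeq d n) v x - inner ℝ (mollify (bumpSeq d n) G x) h‖ₑ ^ p) atTop :=
        lintegral_congr_ae (hlim.mono fun x hx => hx.liminf_eq.symm)
    _ ≤ liminf (fun n => ∫⁻ x in A, ‖mollify (bumpSeq d n) v (x + h) -
          mollify (bumpSeq d n) v x - inner ℝ (mollify (bumpSeq d n) G x) h‖ₑ ^ p) atTop := by
        refine lintegral_liminf_le fun n => ?_
        have h1 : Continuous (mollify (bumpSeq d n) v) := (contDiff_mollify _ hv).continuous
        have h2 : Continuous (mollify (bumpSeq d n) G) := (contDiff_mollify _ hG).continuous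
        exact (ENNReal.continuous_rpow_const.comp (Continuous.enorm (by fun_prop))).measurable
    _ ≤ S * ‖h‖ₑ ^ p := liminf_le_of_frequently_le' hbound.frequently

end Remainder

/-! ### From compact sets to continuous test functions -/

section Weak

variable {d : ℕ} {Ω : Set (EuclideanSpace ℝ (Fin d))}
  {μ : ℝ → Measure (EuclideanSpace ℝ (Fin d))} {m : Measure (EuclideanSpace ℝ (Fin d))}

theorem isCompact_superlevel {F : EuclideanSpace ℝ (Fin d) → ℝ} (hF : Continuous F)
    (hFc : HasCompactSupport F) {t : ℝ} (ht : 0 < t) : IsCompact {x | t ≤ F x} := by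
  refine hFc.isCompact.of_isClosed_subset (isClosed_le continuous_const hF) fun x hx => ?_
  refine subset_tsupport _ (Function.mem_support.2 ?_)
  have : t ≤ F x := hx
  linarith

theorem superlevel_subset_tsupport {F : EuclideanSpace ℝ (Fin d) → ℝ} {t : ℝ} (ht : 0 < t) :
    {x | t ≤ F x} ⊆ tsupport F := by
  intro x hx
  refine subset_tsupport _ (Function.mem_support.2 ?_)
  have : t ≤ F x := hx
  linarith

/-- The frontier is contained in the level set `{F = t}`, and a finite measure charges only
countably many of these disjoint sets. -/
theorem ae_frontier_superlevel_null (hm : ∀ K, IsCompact K → K ⊆ Ω → m K < ⊤)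
    {F : EuclideanSpace ℝ (Fin d) → ℝ} (hF : Continuous F)
    (hFc : HasCompactSupport F) (hFΩ : tsupport F ⊆ Ω) :
    ∀ᵐ t ∂(volume.restrict (Set.Ioi (0 : ℝ))), m (frontier {x | t ≤ F x}) = 0 := by
  have : IsFiniteMeasure (m.restrict (tsupport F)) :=
    ⟨by simpa using hm _ hFc.isCompact hFΩ⟩
  have hc := Measure.countable_meas_level_set_pos (μ := m.restrict (tsupport F)) hF.measurable
  have hnull : ∀ᵐ t : ℝ, ¬ 0 < (m.restrict (tsupport F)) {a | F a = t} :=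
    measure_eq_zero_iff_ae_notMem.1 (hc.measure_zero volume)
  filter_upwards [ae_restrict_of_ae hnull, ae_restrict_mem measurableSet_Ioi] with t ht ht0
  have ht0' : (0 : ℝ) < t := ht0
  rw [not_lt, nonpos_iff_eq_zero, Measure.restrict_apply
    (measurableSet_eq_fun hF.measurable measurable_const)] at ht
  refine measure_mono_null (fun x hx => ?_) ht
  have hx1 := frontier_le_subset_eq continuous_const hF hx
  have hx2 : t = F x := hx1
  refine ⟨hx2.symm, subset_tsupport _ (Function.mem_support.2 ?_)⟩
  linarith

/-- By the layer cake formula the integral is that of `t ↦ μ_ε{F ≥ t}` over `t > 0`. These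
superlevel sets are compact in `Ω`, with null frontier for almost every `t`, and dominated
convergence in `t` applies. -/
theorem tendsto_lintegral_ofReal_of_tendsto_compact
    (hm : ∀ K, IsCompact K → K ⊆ Ω → m K < ⊤)
    (hb : ∀ K, IsCompact K → K ⊆ Ω → ∃ C : ℝ≥0∞, C ≠ ⊤ ∧ ∀ᶠ ε in 𝓝[>] 0, μ ε K ≤ C)
    (h : ∀ K, IsCompact K → K ⊆ Ω → m (frontier K) = 0 →
      Tendsto (fun ε => μ ε K) (𝓝[>] 0) (𝓝 (m K)))
    {F : EuclideanSpace ℝ (Fin d) → ℝ} (hF : Continuous F) (hF0 : ∀ x, 0 ≤ F x)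
    (hFc : HasCompactSupport F) (hFΩ : tsupport F ⊆ Ω) :
    Tendsto (fun ε => ∫⁻ x, ENNReal.ofReal (F x) ∂(μ ε)) (𝓝[>] 0)
      (𝓝 (∫⁻ x, ENNReal.ofReal (F x) ∂m)) := by
  obtain ⟨M, hM⟩ := hF.bounded_above_of_compact_support hFc
  obtain ⟨C, hC, hCb⟩ := hb _ hFc.isCompact hFΩ
  simp_rw [fun ν : Measure (EuclideanSpace ℝ (Fin d)) => lintegral_eq_lintegral_meas_le ν
    (Eventually.of_forall hF0) hF.aemeasurable]
  -- Superlevel sets are empty above `M` and contained in the support of `F` for positive `t`,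
  -- whence the dominating function.
  refine tendsto_lintegral_filter_of_dominated_convergence
    ((Set.Ioc 0 M).indicator fun _ => C) ?_ ?_ ?_ ?_
  · refine Eventually.of_forall fun ε => Antitone.measurable fun s t hst => ?_
    exact measure_mono fun x hx => le_trans hst hx
  · filter_upwards [hCb] with ε hε
    filter_upwards [ae_restrict_mem measurableSet_Ioi] with t ht
    by_cases htM : t ≤ M
    · rw [Set.indicator_of_mem (show t ∈ Set.Ioc 0 M from ⟨ht, htM⟩)]
      exact (measure_mono (superlevel_subset_tsupport ht)).trans hε
    · have : {x | t ≤ F x} = ∅ := by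
        ext x
        simp only [Set.mem_ofPred_eq, Set.mem_empty_iff_false, iff_false, not_le]
        exact ((le_abs_self _).trans (hM x)).trans_lt (not_le.1 htM)
      simp [this]
  · refine ne_top_of_le_ne_top ?_ (setLIntegral_le_lintegral _ _)
    rw [lintegral_indicator measurableSet_Ioc, setLIntegral_const]
    exact ENNReal.mul_ne_top hC (by simp)
  · filter_upwards [ae_frontier_superlevel_null hm hF hFc hFΩ,
      ae_restrict_mem measurableSet_Ioi] with t ht ht0
    exact h _ (isCompact_superlevel hF hFc ht0) ((superlevel_subset_tsupport ht0).trans hFΩ) ht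

theorem integrable_of_finite_on_compacts (hm : ∀ K, IsCompact K → K ⊆ Ω → m K < ⊤)
    {f : EuclideanSpace ℝ (Fin d) → ℝ} (hf : Continuous f)
    (hfc : HasCompactSupport f) (hfΩ : tsupport f ⊆ Ω) : Integrable f m := by
  obtain ⟨M, hM⟩ := hf.bounded_above_of_compact_support hfc
  rw [← integrableOn_iff_integrable_of_support_subset (subset_tsupport f)]
  exact Measure.integrableOn_of_bounded (hm _ hfc.isCompact hfΩ).ne hf.aestronglyMeasurable
    (Eventually.of_forall hM)

theorem convergesWeaklyOn_of_tendsto_compact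
    (hμ : ∀ ε : ℝ, 0 < ε → ∀ K, IsCompact K → K ⊆ Ω → μ ε K < ⊤)
    (hm : ∀ K, IsCompact K → K ⊆ Ω → m K < ⊤)
    (hb : ∀ K, IsCompact K → K ⊆ Ω → ∃ C : ℝ≥0∞, C ≠ ⊤ ∧ ∀ᶠ ε in 𝓝[>] 0, μ ε K ≤ C)
    (h : ∀ K, IsCompact K → K ⊆ Ω → m (frontier K) = 0 →
      Tendsto (fun ε => μ ε K) (𝓝[>] 0) (𝓝 (m K))) :
    ConvergesWeaklyOn Ω μ m := by
  intro f hf hfc hfΩ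
  have key : ∀ f : EuclideanSpace ℝ (Fin d) → ℝ, Continuous f → HasCompactSupport f →
      tsupport f ⊆ Ω → (∫⁻ x, ENNReal.ofReal (f x) ∂m ≠ ⊤) ∧
      Tendsto (fun ε => ∫⁻ x, ENNReal.ofReal (f x) ∂(μ ε)) (𝓝[>] 0)
      (𝓝 (∫⁻ x, ENNReal.ofReal (f x) ∂m)) := by
    intro f hf hfc hfΩ
    have hs : Function.support (fun x => max (f x) 0) ⊆ Function.support f := by
      intro x hx h0
      simp [h0] at hx
    have hts : tsupport (fun x => max (f x) 0) ⊆ tsupport f := closure_mono hs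
    have := tendsto_lintegral_ofReal_of_tendsto_compact hm hb h
      (F := fun x => max (f x) 0) (by fun_prop) (fun x => le_max_right _ _)
      (hfc.mono' (hs.trans subset_closure)) (hts.trans hfΩ)
    simp only [ENNReal.ofReal_max, ENNReal.ofReal_zero, zero_le, sup_of_le_left] at this
    exact ⟨(integrable_of_finite_on_compacts hm hf hfc hfΩ).lintegral_lt_top.ne, this⟩
  obtain ⟨h1, h2⟩ := key f hf hfc hfΩ
  obtain ⟨h3, h4⟩ := key (fun x => -f x) hf.neg hfc.neg (by
    have : tsupport (fun x => -f x) = tsupport f := tsupport_neg f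
    rwa [this])
  rw [integral_eq_lintegral_pos_part_sub_lintegral_neg_part
    (integrable_of_finite_on_compacts hm hf hfc hfΩ)]
  refine (((ENNReal.tendsto_toReal h1).comp h2).sub
    ((ENNReal.tendsto_toReal h3).comp h4)).congr' ?_
  filter_upwards [self_mem_nhdsWithin] with ε hε
  rw [integral_eq_lintegral_pos_part_sub_lintegral_neg_part
    (integrable_of_finite_on_compacts (hμ ε hε) hf hfc hfΩ)]
  rfl

end Weak

/-! ### Limits of two-sided bounds -/

section Limits

variable {l : Filter ℝ} [l.NeBot] {f T κ : ℝ → ℝ≥0∞} {M θ c : ℝ≥0∞}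

theorem limsup_le_of_le_add (hT : Tendsto T l (𝓝 0)) (h : ∀ᶠ ε in l, f ε ≤ M + T ε) :
    limsup f l ≤ M := by
  have h1 : Tendsto (fun ε => M + T ε) l (𝓝 (M + 0)) := hT.const_add M
  rw [add_zero] at h1
  exact (limsup_le_limsup h).trans h1.limsup_eq.le

theorem le_liminf_of_mul_le (hκ : Tendsto κ l (𝓝 1)) (hθ : θ ≠ ⊤)
    (h : ∀ᶠ ε in l, M * κ ε ≤ θ * f ε + c) : M ≤ θ * liminf f l + c := by
  have hMκ : Tendsto (fun ε => M * κ ε) l (𝓝 M) := by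
    have := ENNReal.Tendsto.const_mul (a := M) hκ (Or.inl one_ne_zero)
    rwa [mul_one] at this
  have step : ∀ b, liminf f l < b → M ≤ θ * b + c := by
    intro b hb
    refine le_of_tendsto_of_frequently hMκ ?_
    refine ((frequently_lt_of_liminf_lt (by isBoundedDefault) hb).and_eventually h).mono ?_
    rintro ε ⟨h1, h2⟩
    exact h2.trans (by gcongr)
  -- When the liminf is infinite the right side is infinite unless `θ = 0`; then `f` drops out of
  -- the hypothesis.
  rcases eq_or_ne (liminf f l) ⊤ with ht | ht
  · rcases eq_or_ne θ 0 with rfl | hθ0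
    · have h2 : ∀ᶠ ε in l, M * κ ε ≤ c := h.mono fun ε hε => by simpa using hε
      simpa using le_of_tendsto hMκ h2
    · rw [ht, ENNReal.mul_top hθ0]; simp
  · have hlim : Tendsto (fun b => θ * b + c) (𝓝[>] (liminf f l)) (𝓝 (θ * liminf f l + c)) :=
      ((ENNReal.Tendsto.const_mul tendsto_id (Or.inr hθ)).add_const c).mono_left
        nhdsWithin_le_nhds
    have : (𝓝[>] (liminf f l)).NeBot := nhdsGT_neBot_of_exists_gt ⟨⊤, ht.lt_top⟩
    exact ge_of_tendsto hlim (by filter_upwards [self_mem_nhdsWithin] with b hb using step b hb)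

theorem le_of_forall_one_lt_pos {a b : ℝ≥0∞}
    (h : ∀ θ : ℝ≥0∞, 1 < θ → θ ≠ ⊤ → ∀ η : ℝ≥0∞, 0 < η → η ≠ ⊤ → a ≤ θ * b + η) : a ≤ b := by
  rcases eq_or_ne b ⊤ with rfl | hb
  · exact le_top
  have h1 : ∀ θ : ℝ≥0∞, 1 < θ → θ ≠ ⊤ → a ≤ θ * b := fun θ hθ hθt =>
    ENNReal.le_of_forall_pos_le_add fun η hη _ => h θ hθ hθt η (by simpa using hη) (by simp)
  have hlim : Tendsto (fun θ : ℝ≥0∞ => θ * b) (𝓝[>] 1) (𝓝 (1 * b)) :=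
    (ENNReal.Tendsto.mul_const tendsto_id (Or.inr hb)).mono_left nhdsWithin_le_nhds
  rw [one_mul] at hlim
  have : (𝓝[>] (1 : ℝ≥0∞)).NeBot := nhdsGT_neBot_of_exists_gt ⟨⊤, by simp⟩
  refine ge_of_tendsto hlim ?_
  filter_upwards [Ioo_mem_nhdsGT (show (1 : ℝ≥0∞) < ⊤ by simp)] with θ hθ
  exact h1 θ hθ.1 hθ.2.ne

end Limits

/-! ### The Sobolev case -/

section Sobolev

variable {d : ℕ}

/-- Extension by zero. It preserves integrability but in general no weak differentiability; this
suffices, since derivatives are only examined near compact subsets of `Ω`. -/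
theorem exists_global_representative {F : Type*} [NormedAddCommGroup F]
    {Ω : Set (EuclideanSpace ℝ (Fin d))} (hΩ : MeasurableSet Ω) {q : ℝ≥0∞}
    {f : EuclideanSpace ℝ (Fin d) → F} (hf : MemLp f q (volume.restrict Ω)) :
    ∃ v : EuclideanSpace ℝ (Fin d) → F, StronglyMeasurable v ∧ f =ᵐ[volume.restrict Ω] v ∧
      MemLp v q volume ∧ ∀ x ∉ Ω, v x = 0 := by
  refine ⟨Ω.indicator (hf.1.mk f), hf.1.stronglyMeasurable_mk.indicator hΩ, ?_, ?_,
    fun x hx => Set.indicator_of_notMem hx _⟩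
  · exact hf.1.ae_eq_mk.trans (indicator_ae_eq_restrict hΩ).symm
  · rw [memLp_indicator_iff_restrict hΩ]
    exact hf.ae_eq hf.1.ae_eq_mk

theorem gradientMeasure_apply {K p : ℝ} {Ω A : Set (EuclideanSpace ℝ (Fin d))}
    (hA : MeasurableSet A) (hAΩ : A ⊆ Ω)
    {g G : EuclideanSpace ℝ (Fin d) → EuclideanSpace ℝ (Fin d)} (hG : Measurable G)
    (hgG : g =ᵐ[volume.restrict Ω] G) :
    gradientMeasure K p Ω g A = ENNReal.ofReal K * ∫⁻ x in A, ‖G x‖ₑ ^ p := by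
  rw [gradientMeasure, withDensity_apply _ hA, Measure.restrict_restrict hA,
    Set.inter_eq_left.2 hAΩ, ← lintegral_const_mul _ (hG.enorm.pow_const p)]
  refine lintegral_congr_ae ?_
  filter_upwards [ae_restrict_of_ae_restrict_of_subset hAΩ hgG] with x hx
  rw [hx]

theorem lintegral_enorm_rpow_ne_top {F : Type*} [NormedAddCommGroup F] {p : ℝ} (hp : 0 < p)
    {f : EuclideanSpace ℝ (Fin d) → F} (hf : MemLp f (ENNReal.ofReal p) volume) :
    ∫⁻ x, ‖f x‖ₑ ^ p ≠ ⊤ := by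
  have := lintegral_rpow_enorm_lt_top_of_eLpNorm_lt_top (by simpa using hp)
    ENNReal.ofReal_ne_top hf.2
  rw [ENNReal.toReal_ofReal hp.le] at this
  exact this.ne

theorem exists_closedBall_subset_of_isCompact {Ω E : Set (EuclideanSpace ℝ (Fin d))}
    (hΩ : IsOpen Ω) (hE : IsCompact E) (hEΩ : E ⊆ Ω) :
    ∃ r > 0, ∀ x ∈ E, Metric.closedBall x r ⊆ Ω := by
  obtain ⟨r, hr, h⟩ := hE.exists_cthickening_subset_open hΩ hEΩ
  exact ⟨r, hr, fun x hx => (Metric.closedBall_subset_cthickening hx r).trans h⟩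

variable {p : ℝ} {ν : ℝ → EuclideanSpace ℝ (Fin d) → ℝ≥0∞} {e : EuclideanSpace ℝ (Fin d)}
  {Ω E : Set (EuclideanSpace ℝ (Fin d))} {u v : EuclideanSpace ℝ (Fin d) → ℝ}
  {g G : EuclideanSpace ℝ (Fin d) → EuclideanSpace ℝ (Fin d)}

/-- The essential point is the order of quantifiers: `τ` is fixed before `ε`, so the far mass and
the near mass may pass to their limits 0 and 1. -/
theorem sobolev_energy_bounds (hp : 1 ≤ p) (hν : IsDiracApprox d p ν) (he : ‖e‖ = 1)
    (hΩ : IsOpen Ω) (hE : IsCompact E) (hEΩ : E ⊆ Ω) (hg : HasWeakGradient Ω u g)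
    (huv : u =ᵐ[volume.restrict Ω] v) (hgG : g =ᵐ[volume.restrict Ω] G)
    (hvm : StronglyMeasurable v) (hGm : StronglyMeasurable G)
    (hv : MemLp v (ENNReal.ofReal p) volume) (hG : MemLp G (ENNReal.ofReal p) volume)
    {θ η : ℝ≥0∞} (hθ : 1 < θ) (hη : 0 < η) :
    ∃ τ > 0, τ ≤ 1 ∧ ∀ ε > 0,
      nonlocalMeasure p Ω (ν ε) u E ≤
        θ * gradientMeasure (sphereMean d p e) p Ω g E + η +
          2 ^ (p - 1) * (2 * ∫⁻ x, ‖v x‖ₑ ^ p) * volume.withDensity (ν ε) {h | τ < ‖h‖} ∧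
      gradientMeasure (sphereMean d p e) p Ω g E *
          (∫⁻ h in Metric.closedBall 0 τ, ‖h‖ₑ ^ p ∂(volume.withDensity (ν ε))) ≤
        θ * nonlocalMeasure p Ω (ν ε) u E + η := by
  have hp0 : 0 < p := by linarith
  obtain ⟨C, hC, hCθ⟩ := exists_forall_add_rpow_le hp hθ
  -- The remainder will be multiplied by `C`, so it is made small relative to `C` beforehand.
  obtain ⟨η', hη', hCη⟩ : ∃ η' : ℝ≥0∞, 0 < η' ∧ C * η' ≤ η := by
    rcases eq_or_ne C 0 with rfl | hC0
    · exact ⟨1, one_pos, by simp⟩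
    · exact ⟨η / C, ENNReal.div_pos hη.ne' hC, ENNReal.mul_div_le⟩
  obtain ⟨r, hr, hball⟩ := exists_closedBall_subset_of_isCompact hΩ hE hEΩ
  obtain ⟨τ₀, hτ₀, htrans⟩ := exists_forall_lintegral_translate_le hp hG hη'
  -- The three bounds serve the smallness of translations of `G`, room inside `Ω` (with `r / 2`
  -- giving strict inequality), and the truncation in the Lévy mass.
  set τ := min (min τ₀ (r / 2)) 1 with hτdef
  have hτ : 0 < τ := by positivity
  have hττ₀ : τ ≤ τ₀ := (min_le_left _ _).trans (min_le_left _ _)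
  have hτr : τ ≤ r / 2 := (min_le_left _ _).trans (min_le_right _ _)
  have hrem : ∀ h, ‖h‖ ≤ τ →
      ∫⁻ x in E, ‖v (x + h) - v x - inner ℝ (G x) h‖ₑ ^ p ≤ η' * ‖h‖ₑ ^ p := fun h hh =>
    sobolev_remainder_le hp hg huv hgG (memLp_locallyIntegrable hp hv) hGm
      (memLp_locallyIntegrable hp hG) hE.measurableSet hball (by linarith)
      fun k hk => htrans k (hk.trans (hh.trans hττ₀))
  refine ⟨τ, hτ, min_le_right _ _, fun ε hε => ?_⟩
  have hm := hν.isRadialLevy hε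
  rw [nonlocalMeasure_apply (hν.measurable ε hε) (fun h => hν.radial ε hε _ _ (norm_neg h))
    hΩ.measurableSet hE.measurableSet hEΩ hvm.measurable huv,
    gradientMeasure_apply hE.measurableSet hEΩ hGm.measurable hgG]
  constructor
  · refine (nonlocalEnergy_le hp hvm.measurable τ).trans ?_
    gcongr
    refine (shortEnergy_le_of_remainder hm hp0 he hvm.measurable hGm.measurable
      (min_le_right _ _) hCθ hrem).trans ?_
    gcongr
  · refine (le_shortEnergy_of_remainder hm hp0 he hvm.measurable hGm.measurable
      (min_le_right _ _) hCθ hrem).trans ?_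
    gcongr
    refine shortEnergy_le_nonlocalEnergy hvm.measurable hE.measurableSet fun x hx h hh => ?_
    refine hball x hx ?_
    rw [Metric.mem_closedBall, dist_eq_norm, add_sub_cancel_left]
    linarith

theorem nonlocalMeasure_compl (hΩ : MeasurableSet Ω) (k : EuclideanSpace ℝ (Fin d) → ℝ≥0∞) :
    nonlocalMeasure p Ω k u Ωᶜ = 0 :=
  withDensity_absolutelyContinuous _ _ (by rw [Measure.restrict_apply hΩ.compl]; simp)

theorem tendsto_of_limsup_le_of_le_liminf {f : ℝ → ℝ≥0∞} {l : Filter ℝ} {a : ℝ≥0∞}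
    (h1 : limsup f l ≤ a) (h2 : a ≤ liminf f l) : Tendsto f l (𝓝 a) :=
  tendsto_of_le_liminf_of_limsup_le h2 h1

theorem eventually_le_of_tendsto {f : ℝ → ℝ≥0∞} {a : ℝ≥0∞} (ha : a ≠ ⊤)
    {l : Filter ℝ} (h : limsup f l ≤ a) : ∃ C : ℝ≥0∞, C ≠ ⊤ ∧ ∀ᶠ ε in l, f ε ≤ C := by
  refine ⟨a + 1, by simp [ha], ?_⟩
  have : limsup f l < a + 1 := h.trans_lt (ENNReal.lt_add_right ha one_ne_zero)
  exact (eventually_lt_of_limsup_lt this).mono fun _ h => h.le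

theorem nonlocalMeasure_sobolev (hp : 1 ≤ p) (hν : IsDiracApprox d p ν) (he : ‖e‖ = 1)
    (hΩ : IsOpen Ω) (hu : IsSobolevWithGradient p Ω u g) :
    (∀ ε : ℝ, 0 < ε → IsRadonOn Ω (nonlocalMeasure p Ω (ν ε) u)) ∧
    IsRadonOn Ω (gradientMeasure (sphereMean d p e) p Ω g) ∧
    ConvergesWeaklyOn Ω (fun ε => nonlocalMeasure p Ω (ν ε) u)
      (gradientMeasure (sphereMean d p e) p Ω g) ∧
    ∀ E : Set (EuclideanSpace ℝ (Fin d)), IsCompact E → E ⊆ Ω →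
      Tendsto (fun ε : ℝ => nonlocalMeasure p Ω (ν ε) u E) (𝓝[>] 0)
        (𝓝 (gradientMeasure (sphereMean d p e) p Ω g E)) := by
  have hp0 : 0 < p := by linarith
  obtain ⟨v, hvm, huv, hv, -⟩ := exists_global_representative hΩ.measurableSet hu.memLp
  obtain ⟨G, hGm, hgG, hG, -⟩ := exists_global_representative hΩ.measurableSet hu.memLp_gradient
  have hgrad : ∀ E, IsCompact E → E ⊆ Ω → gradientMeasure (sphereMean d p e) p Ω g E < ⊤ := by
    intro E hE hEΩ
    rw [gradientMeasure_apply hE.measurableSet hEΩ hGm.measurable hgG]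
    refine ENNReal.mul_lt_top ENNReal.ofReal_lt_top ?_
    exact (setLIntegral_le_lintegral _ _).trans_lt (lintegral_enorm_rpow_ne_top hp0 hG).lt_top
  have hconst : (2 : ℝ≥0∞) ^ (p - 1) * (2 * ∫⁻ x, ‖v x‖ₑ ^ p) ≠ ⊤ :=
    ENNReal.mul_ne_top (ENNReal.rpow_ne_top_of_nonneg (by linarith) (by simp))
      (ENNReal.mul_ne_top (by simp) (lintegral_enorm_rpow_ne_top hp0 hv))
  have hfin : ∀ ε : ℝ, 0 < ε → ∀ E, IsCompact E → E ⊆ Ω →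
      nonlocalMeasure p Ω (ν ε) u E < ⊤ := by
    intro ε hε E hE hEΩ
    -- Finiteness at fixed `ε` needs no smallness, so `θ = 2` and `η = 1` are arbitrary choices.
    obtain ⟨τ, hτ, -, hb⟩ := sobolev_energy_bounds hp hν he hΩ hE hEΩ hu.gradient huv hgG hvm
      hGm hv hG (show (1 : ℝ≥0∞) < 2 by norm_num) one_pos
    refine (hb ε hε).1.trans_lt ?_
    refine ENNReal.add_lt_top.2 ⟨ENNReal.add_lt_top.2
      ⟨ENNReal.mul_lt_top (by simp) (hgrad E hE hEΩ), by simp⟩, ?_⟩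
    exact ENNReal.mul_lt_top hconst.lt_top
      ((hν.isRadialLevy hε).measure_norm_gt_ne_top hp0 hτ).lt_top
  have hlim : ∀ E, IsCompact E → E ⊆ Ω →
      Tendsto (fun ε : ℝ => nonlocalMeasure p Ω (ν ε) u E) (𝓝[>] 0)
        (𝓝 (gradientMeasure (sphereMean d p e) p Ω g E)) := by
    intro E hE hEΩ
    refine tendsto_of_limsup_le_of_le_liminf ?_ ?_
    · refine le_of_forall_one_lt_pos fun θ hθ hθt η hη _ => ?_
      obtain ⟨τ, hτ, hτ1, hb⟩ := sobolev_energy_bounds hp hν he hΩ hE hEΩ hu.gradient huv hgG hvm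
        hGm hv hG hθ hη
      have hT := ENNReal.Tendsto.const_mul (hν.tendsto_measure_norm_gt hp0 hτ) (Or.inr hconst)
      rw [mul_zero] at hT
      refine limsup_le_of_le_add hT ?_
      filter_upwards [self_mem_nhdsWithin] with ε hε using (hb ε hε).1
    · refine le_of_forall_one_lt_pos fun θ hθ hθt η hη _ => ?_
      obtain ⟨τ, hτ, hτ1, hb⟩ := sobolev_energy_bounds hp hν he hΩ hE hEΩ hu.gradient huv hgG hvm
        hGm hv hG hθ hη
      refine le_liminf_of_mul_le (hν.tendsto_setLIntegral_closedBall hp0 hτ hτ1) hθt ?_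
      filter_upwards [self_mem_nhdsWithin] with ε hε using (hb ε hε).2
  refine ⟨fun ε hε => ⟨nonlocalMeasure_compl hΩ.measurableSet _, hfin ε hε⟩, ⟨?_, hgrad⟩,
    convergesWeaklyOn_of_tendsto_compact hfin hgrad (fun K hK hKΩ => ?_)
      (fun K hK hKΩ _ => hlim K hK hKΩ), hlim⟩
  · exact withDensity_absolutelyContinuous _ _
      (by rw [Measure.restrict_apply hΩ.measurableSet.compl]; simp)
  · exact eventually_le_of_tendsto (hgrad K hK hKΩ).ne (hlim K hK hKΩ).limsup_eq.le

end Sobolev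

/-! ### Calculus of the divergence -/

section Divergence

variable {d : ℕ} {φ ψ : EuclideanSpace ℝ (Fin d) → EuclideanSpace ℝ (Fin d)}
  {v : EuclideanSpace ℝ (Fin d) → ℝ}

theorem continuous_divergence (hφ : ContDiff ℝ ∞ φ) : Continuous (divergence φ) := by
  have h : Continuous (fderiv ℝ φ) := hφ.continuous_fderiv (by simp)
  unfold divergence
  refine continuous_finsetSum _ fun i _ => ?_
  exact (EuclideanSpace.proj (𝕜 := ℝ) i).continuous.comp (h.clm_apply continuous_const)

theorem divergence_eq_zero_of_notMem {x : EuclideanSpace ℝ (Fin d)} (hx : x ∉ tsupport φ) :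
    divergence φ x = 0 := by
  have : fderiv ℝ φ x = 0 := by
    by_contra hne
    exact hx (support_fderiv_subset ℝ hne)
  simp [divergence, this]

theorem exists_bound_divergence (hφ : ContDiff ℝ ∞ φ) (hφc : HasCompactSupport φ) :
    ∃ C, ∀ x, ‖divergence φ x‖ ≤ C :=
  (continuous_divergence hφ).bounded_above_of_compact_support
    (HasCompactSupport.intro hφc.isCompact fun _ hx => divergence_eq_zero_of_notMem hx)

theorem integrable_mul_divergence (hv : Integrable v) (hφ : ContDiff ℝ ∞ φ)
    (hφc : HasCompactSupport φ) : Integrable fun x => v x * divergence φ x := by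
  obtain ⟨C, hC⟩ := exists_bound_divergence hφ hφc
  exact hv.mul_bdd (continuous_divergence hφ).aestronglyMeasurable (Eventually.of_forall hC)

theorem divergence_zero : divergence (0 : EuclideanSpace ℝ (Fin d) → _) = 0 := by
  ext x; simp [divergence]

theorem divergence_sum {ι : Type*} (s : Finset ι)
    {Φ : ι → EuclideanSpace ℝ (Fin d) → EuclideanSpace ℝ (Fin d)}
    (hΦ : ∀ i, ContDiff ℝ ∞ (Φ i)) (x : EuclideanSpace ℝ (Fin d)) :
    divergence (fun x => ∑ i ∈ s, Φ i x) x = ∑ i ∈ s, divergence (Φ i) x := by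
  unfold divergence
  rw [fderiv_fun_sum fun i _ => (hΦ i).differentiable (by simp) x, Finset.sum_comm]
  simp

theorem divergence_add (hφ : ContDiff ℝ ∞ φ) (hψ : ContDiff ℝ ∞ ψ)
    (x : EuclideanSpace ℝ (Fin d)) :
    divergence (fun x => φ x + ψ x) x = divergence φ x + divergence ψ x := by
  unfold divergence
  rw [fderiv_fun_add (hφ.differentiable (by simp) x) (hψ.differentiable (by simp) x)]
  simp [Finset.sum_add_distrib]

end Divergence

/-! ### Construction and uniqueness of the variation measure -/

section Variation

variable {d : ℕ} {v : EuclideanSpace ℝ (Fin d) → ℝ} {U W : Set (EuclideanSpace ℝ (Fin d))}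

/-- The total variation on `U` of a function defined on the whole space. -/
noncomputable def totalVariation (v : EuclideanSpace ℝ (Fin d) → ℝ)
    (U : Set (EuclideanSpace ℝ (Fin d))) : ℝ≥0∞ :=
  ⨆ φ ∈ testFields U, ENNReal.ofReal (∫ x, v x * divergence φ x)

theorem zero_mem_testFields (U : Set (EuclideanSpace ℝ (Fin d))) : 0 ∈ testFields U :=
  ⟨contDiff_const, HasCompactSupport.zero, by simp [tsupport], by simp⟩

theorem testFields_mono (h : U ⊆ W) : testFields U ⊆ testFields W :=
  fun _ hφ => ⟨hφ.1, hφ.2.1, hφ.2.2.1.trans h, hφ.2.2.2⟩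

theorem totalVariation_mono (h : U ⊆ W) : totalVariation v U ≤ totalVariation v W :=
  biSup_mono fun _ hφ => testFields_mono h hφ

theorem ofReal_le_totalVariation {φ : EuclideanSpace ℝ (Fin d) → EuclideanSpace ℝ (Fin d)}
    (hφ : φ ∈ testFields U) :
    ENNReal.ofReal (∫ x, v x * divergence φ x) ≤ totalVariation v U :=
  le_iSup₂_of_le φ hφ le_rfl

theorem bvVariation_eq_totalVariation {Ω : Set (EuclideanSpace ℝ (Fin d))}
    {u : EuclideanSpace ℝ (Fin d) → ℝ} (huv : u =ᵐ[volume.restrict Ω] v) (hU : U ⊆ Ω) :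
    bvVariation U u = totalVariation v U := by
  unfold bvVariation totalVariation
  refine iSup_congr fun φ => iSup_congr fun hφ => congrArg ENNReal.ofReal ?_
  rw [integral_congr_ae (g := fun x => v x * divergence φ x)
    ((ae_restrict_of_ae_restrict_of_subset hU huv).mono fun x hx => by simp [hx])]
  refine setIntegral_eq_integral_of_forall_compl_eq_zero fun x hx => ?_
  rw [divergence_eq_zero_of_notMem fun h => hx (hφ.2.2.1 h), mul_zero]

theorem totalVariation_empty : totalVariation v ∅ = 0 := by
  refine le_antisymm (iSup₂_le fun φ hφ => ?_) zero_le
  have : φ = 0 := by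
    rw [← tsupport_eq_empty_iff]
    exact Set.subset_empty_iff.1 hφ.2.2.1
  simp [this, divergence_zero]

/-- Test fields supported in disjoint sets can be added without violating the pointwise bound 1. A
field with nonpositive integral contributes zero and is simply dropped. -/
theorem totalVariation_add_le (hv : Integrable v) (hUW : Disjoint U W) :
    totalVariation v U + totalVariation v W ≤ totalVariation v (U ∪ W) := by
  refine ENNReal.biSup_add_biSup_le' ⟨0, zero_mem_testFields U⟩ ⟨0, zero_mem_testFields W⟩
    fun φ hφ ψ hψ => ?_
  rcases le_total (∫ x, v x * divergence φ x) 0 with h1 | h1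
  · rw [ENNReal.ofReal_of_nonpos h1, zero_add]
    exact (ofReal_le_totalVariation hψ).trans (totalVariation_mono Set.subset_union_right)
  rcases le_total (∫ x, v x * divergence ψ x) 0 with h2 | h2
  · rw [ENNReal.ofReal_of_nonpos h2, add_zero]
    exact (ofReal_le_totalVariation hφ).trans (totalVariation_mono Set.subset_union_left)
  rw [← ENNReal.ofReal_add h1 h2, ← integral_add (integrable_mul_divergence hv hφ.1 hφ.2.1)
    (integrable_mul_divergence hv hψ.1 hψ.2.1)]
  simp_rw [← mul_add, ← divergence_add hφ.1 hψ.1]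
  refine ofReal_le_totalVariation ⟨hφ.1.add hψ.1, hφ.2.1.add hψ.2.1, ?_, fun x => ?_⟩
  · exact (tsupport_add φ ψ).trans (Set.union_subset_union hφ.2.2.1 hψ.2.2.1)
  · by_cases hx : x ∈ U
    · have : ψ x = 0 := image_eq_zero_of_notMem_tsupport fun h =>
        Set.disjoint_left.1 hUW hx (hψ.2.2.1 h)
      simpa [this] using hφ.2.2.2 x
    · have : φ x = 0 := image_eq_zero_of_notMem_tsupport fun h => hx (hφ.2.2.1 h)
      simpa [this] using hψ.2.2.2 x

open scoped Manifold in
-- The compact support of a test field meets finitely many pieces; multiplying by a smooth partition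
-- of unity splits the field into admissible fields on these pieces.
theorem totalVariation_iUnion_le (hv : Integrable v) {S : ℕ → Set (EuclideanSpace ℝ (Fin d))}
    (hS : ∀ i, IsOpen (S i)) :
    totalVariation v (⋃ i, S i) ≤ ∑' i, totalVariation v (S i) := by
  refine iSup₂_le fun φ hφ => ?_
  obtain ⟨s, hs⟩ := hφ.2.1.isCompact.elim_finite_subcover S hS hφ.2.2.1
  obtain ⟨f, hf⟩ := SmoothPartitionOfUnity.exists_isSubordinate
    (𝓘(ℝ, EuclideanSpace ℝ (Fin d))) (isClosed_tsupport φ) (fun i : s => S i)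
    (fun i => hS i) (hs.trans (by
      intro x hx
      simp only [Set.mem_iUnion] at hx ⊢
      obtain ⟨i, hi, hx⟩ := hx
      exact ⟨⟨i, hi⟩, hx⟩))
  have hmem : ∀ i : s, (fun x => f i x • φ x) ∈ testFields (S i) := by
    intro i
    refine ⟨(f i).contMDiff.contDiff.smul hφ.1, hφ.2.1.smul_left (f := f i), ?_, fun x => ?_⟩
    · exact (tsupport_smul_subset_left (f i) φ).trans (hf i)
    · rw [norm_smul, Real.norm_of_nonneg (f.nonneg i x)]
      exact mul_le_one₀ (f.le_one i x) (norm_nonneg _) (hφ.2.2.2 x)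
  have hsum : φ = fun x => ∑ i, f i x • φ x := by
    ext1 x
    by_cases hx : x ∈ tsupport φ
    · have := f.sum_eq_one hx
      rw [finsum_eq_sum_of_fintype] at this
      rw [← Finset.sum_smul, this, one_smul]
    · simp [image_eq_zero_of_notMem_tsupport hx]
  calc ENNReal.ofReal (∫ x, v x * divergence φ x)
      = ENNReal.ofReal (∑ i, ∫ x, v x * divergence (fun x => f i x • φ x) x) := by
        rw [← integral_finsetSum _ fun i _ => integrable_mul_divergence hv (hmem i).1 (hmem i).2.1]
        congr 1
        refine integral_congr_ae (Eventually.of_forall fun x => ?_)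
        dsimp only
        conv_lhs => rw [hsum]
        rw [divergence_sum _ fun i => (hmem i).1, Finset.mul_sum]
    _ ≤ ∑ i, ENNReal.ofReal (∫ x, v x * divergence (fun x => f i x • φ x) x) :=
        Finset.le_sum_of_subadditive ENNReal.ofReal ENNReal.ofReal_zero.le
          (fun _ _ => ENNReal.ofReal_add_le) _ _
    _ ≤ ∑ i : s, totalVariation v (S i) :=
        Finset.sum_le_sum fun i _ => ofReal_le_totalVariation (hmem i)
    _ = ∑ i ∈ s, totalVariation v (S i) := Finset.sum_coe_sort s fun i => totalVariation v (S i)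
    _ ≤ ∑' i, totalVariation v (S i) := ENNReal.sum_le_tsum s

/-- The outer measure generated by the variation of `v` on open subsets of `Ω`. -/
noncomputable def variationOuterMeasure (v : EuclideanSpace ℝ (Fin d) → ℝ)
    (Ω : Set (EuclideanSpace ℝ (Fin d))) : OuterMeasure (EuclideanSpace ℝ (Fin d)) :=
  inducedOuterMeasure (P := IsOpen) (fun s _ => totalVariation v (s ∩ Ω)) isOpen_empty
    (by simp [totalVariation_empty])

variable {Ω : Set (EuclideanSpace ℝ (Fin d))}

theorem totalVariation_iUnion_inter_le (hv : Integrable v) (hΩ : IsOpen Ω)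
    {S : ℕ → Set (EuclideanSpace ℝ (Fin d))} (hS : ∀ i, IsOpen (S i)) :
    totalVariation v ((⋃ i, S i) ∩ Ω) ≤ ∑' i, totalVariation v (S i ∩ Ω) := by
  rw [Set.iUnion_inter]
  exact totalVariation_iUnion_le hv fun i => (hS i).inter hΩ

theorem variationOuterMeasure_eq_iInf (hv : Integrable v) (hΩ : IsOpen Ω)
    (s : Set (EuclideanSpace ℝ (Fin d))) :
    variationOuterMeasure v Ω s =
      ⨅ (t : Set (EuclideanSpace ℝ (Fin d))) (_ : IsOpen t) (_ : s ⊆ t),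
        totalVariation v (t ∩ Ω) :=
  inducedOuterMeasure_eq_iInf (fun _ h => isOpen_iUnion h)
    (fun _ h => totalVariation_iUnion_inter_le hv hΩ h)
    (fun _ _ _ _ h => totalVariation_mono (Set.inter_subset_inter_left _ h)) s

theorem variationOuterMeasure_isOpen (hv : Integrable v) (hΩ : IsOpen Ω) (hU : IsOpen U) :
    variationOuterMeasure v Ω U = totalVariation v (U ∩ Ω) :=
  inducedOuterMeasure_eq' (fun _ h => isOpen_iUnion h)
    (fun _ h => totalVariation_iUnion_inter_le hv hΩ h)
    (fun _ _ _ _ h => totalVariation_mono (Set.inter_subset_inter_left _ h)) hU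

/-- Sets at positive distance are separated by the disjoint open sets of points closer to one than
to the other. Superadditivity of the variation inside any open `W` containing both sets then gives
additivity. -/
theorem isMetric_variationOuterMeasure (hv : Integrable v) (hΩ : IsOpen Ω) :
    (variationOuterMeasure v Ω).IsMetric := by
  intro s t hst
  refine le_antisymm (measure_union_le s t) ?_
  rw [variationOuterMeasure_eq_iInf hv hΩ (s ∪ t)]
  refine le_iInf₂ fun W hW => le_iInf fun hsub => ?_
  obtain ⟨r, hr0, hr⟩ := hst
  have hr0 := pos_iff_ne_zero.2 hr0
  have hcs : Continuous fun x => Metric.infEDist x s := Metric.continuous_infEDist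
  have hct : Continuous fun x => Metric.infEDist x t := Metric.continuous_infEDist
  set A := {x | Metric.infEDist x s < Metric.infEDist x t} with hA
  set B := {x | Metric.infEDist x t < Metric.infEDist x s} with hB
  have hAo : IsOpen A := isOpen_lt hcs hct
  have hBo : IsOpen B := isOpen_lt hct hcs
  have hsA : s ⊆ A := fun x hx => by
    have h1 : r ≤ Metric.infEDist x t := Metric.le_infEDist.2 fun y hy => hr x hx y hy
    have h2 : Metric.infEDist x s = 0 := Metric.infEDist_zero_of_mem hx
    exact (h2.trans_lt hr0).trans_le h1
  have htB : t ⊆ B := fun y hy => by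
    have h1 : r ≤ Metric.infEDist y s := Metric.le_infEDist.2 fun x hx => by
      rw [edist_comm]; exact hr x hx y hy
    have h2 : Metric.infEDist y t = 0 := Metric.infEDist_zero_of_mem hy
    exact (h2.trans_lt hr0).trans_le h1
  have hAB : Disjoint A B := Set.disjoint_left.2 fun x h1 h2 => by
    simp only [hA, hB, Set.mem_ofPred_eq] at h1 h2
    exact lt_asymm h1 h2
  calc variationOuterMeasure v Ω s + variationOuterMeasure v Ω t
      ≤ variationOuterMeasure v Ω (W ∩ A) + variationOuterMeasure v Ω (W ∩ B) :=
        add_le_add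
          (measure_mono (Set.subset_inter (Set.subset_union_left.trans hsub) hsA))
          (measure_mono (Set.subset_inter (Set.subset_union_right.trans hsub) htB))
    _ = totalVariation v (W ∩ A ∩ Ω) + totalVariation v (W ∩ B ∩ Ω) := by
        rw [variationOuterMeasure_isOpen hv hΩ (hW.inter hAo),
          variationOuterMeasure_isOpen hv hΩ (hW.inter hBo)]
    _ ≤ totalVariation v (W ∩ A ∩ Ω ∪ W ∩ B ∩ Ω) :=
        totalVariation_add_le hv (hAB.mono (fun _ h => h.1.2) fun _ h => h.1.2)
    _ ≤ totalVariation v (W ∩ Ω) := totalVariation_mono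
        (Set.union_subset (fun _ h => ⟨h.1.1, h.2⟩) fun _ h => ⟨h.1.1, h.2⟩)

/-- Borel sets are Carathéodory measurable for a metric outer measure, and on open sets the outer
measure is the variation itself. Restricting to `Ω` kills the complement. -/
theorem exists_isVariationMeasure {u : EuclideanSpace ℝ (Fin d) → ℝ} (hv : Integrable v)
    (hΩ : IsOpen Ω) (huv : u =ᵐ[volume.restrict Ω] v) :
    ∃ Λ, IsVariationMeasure Ω u Λ := by
  have hle : (inferInstance : MeasurableSpace (EuclideanSpace ℝ (Fin d))) ≤
      (variationOuterMeasure v Ω).caratheodory := by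
    rw [BorelSpace.measurable_eq (α := EuclideanSpace ℝ (Fin d))]
    exact (isMetric_variationOuterMeasure hv hΩ).borel_le_caratheodory
  refine ⟨((variationOuterMeasure v Ω).toMeasure hle).restrict Ω, ?_, fun U hU hUΩ => ?_⟩
  · rw [Measure.restrict_apply hΩ.measurableSet.compl]; simp
  · rw [Measure.restrict_apply hU.measurableSet, Set.inter_eq_left.2 hUΩ,
      toMeasure_apply _ _ hU.measurableSet, variationOuterMeasure_isOpen hv hΩ hU,
      Set.inter_eq_left.2 hUΩ, bvVariation_eq_totalVariation huv hUΩ]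

theorem IsVariationMeasure.apply_isOpen {u : EuclideanSpace ℝ (Fin d) → ℝ}
    {Λ : Measure (EuclideanSpace ℝ (Fin d))} (h : IsVariationMeasure Ω u Λ) (hΩ : IsOpen Ω)
    (hU : IsOpen U) : Λ U = bvVariation (U ∩ Ω) u := by
  have h0 : Λ (U \ Ω) = 0 := measure_mono_null (fun x hx => hx.2) h.1
  rw [← h.2 _ (hU.inter hΩ) Set.inter_subset_right, ← measure_inter_add_sdiff U hΩ.measurableSet,
    h0, add_zero]

theorem IsVariationMeasure.isFiniteMeasure {u : EuclideanSpace ℝ (Fin d) → ℝ}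
    {Λ : Measure (EuclideanSpace ℝ (Fin d))} (h : IsVariationMeasure Ω u Λ) (hΩ : IsOpen Ω)
    (hu : bvVariation Ω u < ⊤) : IsFiniteMeasure Λ :=
  ⟨by rwa [h.apply_isOpen hΩ isOpen_univ, Set.univ_inter]⟩

/-- Finite measures that agree on the π-system of open sets coincide. Being null off `Ω` determines
the values on open sets not contained in `Ω`. -/
theorem IsVariationMeasure.unique {u : EuclideanSpace ℝ (Fin d) → ℝ}
    {Λ₁ Λ₂ : Measure (EuclideanSpace ℝ (Fin d))} (h₁ : IsVariationMeasure Ω u Λ₁)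
    (h₂ : IsVariationMeasure Ω u Λ₂) (hΩ : IsOpen Ω) (hu : bvVariation Ω u < ⊤) : Λ₁ = Λ₂ := by
  have := h₁.isFiniteMeasure hΩ hu
  refine ext_of_generate_finite {s | IsOpen s} ?_ isPiSystem_isOpen (fun s hs => ?_) ?_
  · exact BorelSpace.measurable_eq
  · rw [h₁.apply_isOpen hΩ hs, h₂.apply_isOpen hΩ hs]
  · rw [h₁.apply_isOpen hΩ isOpen_univ, h₂.apply_isOpen hΩ isOpen_univ]

end Variation

/-! ### Gradients and a smooth substitute for their direction -/

section GradientVector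

variable {d : ℕ} {v : EuclideanSpace ℝ (Fin d) → ℝ}

/-- The vector of partial derivatives. -/
noncomputable def gradVec (v : EuclideanSpace ℝ (Fin d) → ℝ) (x : EuclideanSpace ℝ (Fin d)) :
    EuclideanSpace ℝ (Fin d) :=
  WithLp.toLp 2 fun i => fderiv ℝ v x (EuclideanSpace.single i 1)

theorem inner_gradVec (v : EuclideanSpace ℝ (Fin d) → ℝ) (x k : EuclideanSpace ℝ (Fin d)) :
    inner ℝ (gradVec v x) k = fderiv ℝ v x k := by
  rw [continuousLinearMap_apply_eq_sum]
  simp [PiLp.inner_apply, gradVec, mul_comm]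

theorem contDiff_gradVec (hv : ContDiff ℝ ∞ v) : ContDiff ℝ ∞ (gradVec v) := by
  rw [contDiff_euclidean]
  intro i
  exact (hv.fderiv_right (m := ∞) (by simp)).clm_apply contDiff_const

/-- For `a ≠ 0` this is a smooth regularisation of the direction of `a`. -/
noncomputable def regularizedDirection (s : ℝ) (a : EuclideanSpace ℝ (Fin d)) :
    EuclideanSpace ℝ (Fin d) :=
  (√(‖a‖ ^ 2 + s ^ 2))⁻¹ • a

theorem contDiff_regularizedDirection {s : ℝ} (hs : 0 < s) :
    ContDiff ℝ ∞ (regularizedDirection s : EuclideanSpace ℝ (Fin d) → _) := by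
  have hpos : ∀ a : EuclideanSpace ℝ (Fin d), 0 < ‖a‖ ^ 2 + s ^ 2 := fun a => by positivity
  have h1 : ContDiff ℝ ∞ fun a : EuclideanSpace ℝ (Fin d) => ‖a‖ ^ 2 + s ^ 2 :=
    (contDiff_norm_sq ℝ).add contDiff_const
  exact ((h1.sqrt fun a => (hpos a).ne').inv fun a => (Real.sqrt_pos.2 (hpos a)).ne').smul
    contDiff_id

theorem norm_regularizedDirection_le {s : ℝ} (hs : 0 < s) (a : EuclideanSpace ℝ (Fin d)) :
    ‖regularizedDirection s a‖ ≤ 1 := by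
  have hpos : 0 < √(‖a‖ ^ 2 + s ^ 2) := Real.sqrt_pos.2 (by positivity)
  rw [regularizedDirection, norm_smul, norm_inv, Real.norm_of_nonneg hpos.le,
    inv_mul_le_one₀ hpos]
  exact Real.le_sqrt_of_sq_le (by nlinarith [sq_nonneg s])

/-- From `√(‖a‖² + s²) ≤ ‖a‖ + s` and `(‖a‖ - s)(‖a‖ + s) ≤ ‖a‖²`. Thus a smooth field of norm at
most 1 recovers `‖a‖` up to `s`. -/
theorem le_inner_regularizedDirection {s : ℝ} (hs : 0 < s) (a : EuclideanSpace ℝ (Fin d)) :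
    ‖a‖ - s ≤ inner ℝ a (regularizedDirection s a) := by
  have hpos : 0 < √(‖a‖ ^ 2 + s ^ 2) := Real.sqrt_pos.2 (by positivity)
  have hle : √(‖a‖ ^ 2 + s ^ 2) ≤ ‖a‖ + s :=
    Real.sqrt_le_iff.2 ⟨by positivity, by nlinarith [norm_nonneg a]⟩
  rw [regularizedDirection, real_inner_smul_right, real_inner_self_eq_norm_sq, inv_mul_eq_div,
    le_div_iff₀ hpos]
  rcases le_total (‖a‖ - s) 0 with h | h
  · nlinarith [sq_nonneg ‖a‖, mul_nonneg (neg_nonneg.2 h) hpos.le]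
  · nlinarith [mul_le_mul_of_nonneg_left hle h, sq_nonneg s]

end GradientVector

/-! ### Variation and gradients of mollifications -/

section MollifiedFields

variable {d : ℕ} {v : EuclideanSpace ℝ (Fin d) → ℝ} {U K : Set (EuclideanSpace ℝ (Fin d))}
  {φ : EuclideanSpace ℝ (Fin d) → EuclideanSpace ℝ (Fin d)}
  (b : ContDiffBump (0 : EuclideanSpace ℝ (Fin d)))

theorem tsupport_mollify_subset {F : Type*} [NormedAddCommGroup F] [NormedSpace ℝ F]
    (f : EuclideanSpace ℝ (Fin d) → F) :
    tsupport (mollify b f) ⊆ Metric.cthickening b.rOut (tsupport f) := by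
  refine closure_minimal (fun y hy => ?_) Metric.isClosed_cthickening
  by_contra hn
  refine hy ?_
  rw [mollify_apply]
  refine integral_eq_zero_of_ae (Eventually.of_forall fun t => ?_)
  by_cases ht : t ∈ Metric.ball 0 b.rOut
  · have : f (y - t) = 0 := by
      refine image_eq_zero_of_notMem_tsupport fun hmem => hn ?_
      refine Metric.mem_cthickening_of_dist_le y (y - t) _ _ hmem ?_
      simpa [dist_eq_norm] using (mem_ball_zero_iff.1 ht).le
    simp [this]
  · have : b.normed volume t = 0 := by
      rw [← Function.notMem_support, b.support_normed_eq]; exact ht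
    simp [this]

theorem mollify_mem_testFields (hφ : Continuous φ) (hφc : HasCompactSupport φ)
    (hφ1 : ∀ x, ‖φ x‖ ≤ 1) (hsub : Metric.cthickening b.rOut (tsupport φ) ⊆ U) :
    mollify b φ ∈ testFields U := by
  have hts := tsupport_mollify_subset b φ
  refine ⟨contDiff_mollify b (hφ.integrable_of_hasCompactSupport hφc).locallyIntegrable,
    hφc.isCompact.cthickening.of_isClosed_subset (isClosed_tsupport _) hts, hts.trans hsub,
    fun x => ?_⟩
  have h1 : ‖mollify b φ x‖ₑ ≤ ∫⁻ t, ‖φ (x - t)‖ₑ ∂(bumpMeasure b) :=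
    enorm_integral_normed_smul_le b
      (aestronglyMeasurable_comp_sub_left hφ.aestronglyMeasurable x)
  have h2 : ∫⁻ t, ‖φ (x - t)‖ₑ ∂(bumpMeasure b) ≤ ∫⁻ t, 1 ∂(bumpMeasure b) := by
    refine lintegral_mono fun t => ?_
    rw [← ofReal_norm, ← ENNReal.ofReal_one]
    exact ENNReal.ofReal_le_ofReal (hφ1 _)
  have h3 := h1.trans h2
  rw [lintegral_const, measure_univ, mul_one, ← ofReal_norm, ← ENNReal.ofReal_one] at h3
  exact (ENNReal.ofReal_le_ofReal_iff zero_le_one).1 h3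

open scoped Manifold in
theorem exists_cutoff (K : Set (EuclideanSpace ℝ (Fin d))) (hK : IsCompact K) {ρ : ℝ}
    (hρ : 0 < ρ) :
    ∃ χ : EuclideanSpace ℝ (Fin d) → ℝ, ContDiff ℝ ∞ χ ∧ HasCompactSupport χ ∧
      tsupport χ ⊆ Metric.cthickening ρ K ∧ (∀ x, χ x ∈ Set.Icc (0 : ℝ) 1) ∧
      ∀ x ∈ K, χ x = 1 := by
  obtain ⟨χ, h1, h2, h3, h4⟩ := exists_contMDiff_support_eq_eq_one_iff
    (𝓘(ℝ, EuclideanSpace ℝ (Fin d))) (n := ⊤) (Metric.isOpen_thickening (δ := ρ) (E := K))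
    hK.isClosed (Metric.self_subset_thickening hρ K)
  have hts : tsupport χ ⊆ Metric.cthickening ρ K := by
    rw [tsupport, h3]
    exact Metric.closure_thickening_subset_cthickening ρ K
  exact ⟨χ, h1.contDiff, hK.cthickening.of_isClosed_subset (isClosed_tsupport _) hts, hts,
    fun x => h2 ⟨x, rfl⟩, fun x hx => (h4 x).1 hx⟩

/-- Test `v` with the mollification of `-χ a/√(‖a‖² + s²)`, where `a` is the gradient of the
mollified `v` and `χ` a cutoff. By duality the variation is at least `∫ χ‖a‖ - s ∫ χ`; let `s → 0`.
-/
theorem lintegral_gradVec_mollify_le (hv : Integrable v) (hK : IsCompact K) {δ : ℝ}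
    (hδ : b.rOut < δ) (hKU : Metric.cthickening δ K ⊆ U) :
    ∫⁻ x in K, ‖gradVec (mollify b v) x‖ₑ ≤ totalVariation v U := by
  set a := gradVec (mollify b v) with ha
  have hsm : ContDiff ℝ ∞ a := contDiff_gradVec (contDiff_mollify b hv.locallyIntegrable)
  -- The cutoff spreads by `δ - b.rOut` only, leaving `b.rOut` for the later mollification of the
  -- field.
  obtain ⟨χ, hχ, hχc, hχs, hχ01, hχ1⟩ := exists_cutoff K hK (sub_pos.2 hδ)
  have hint : Integrable fun x => χ x * ‖a x‖ :=
    (hχ.continuous.mul hsm.continuous.norm).integrable_of_hasCompactSupport hχc.mul_right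
  have hχint : Integrable χ := hχ.continuous.integrable_of_hasCompactSupport hχc
  have step : ∀ s : ℝ, 0 < s →
      ENNReal.ofReal ((∫ x, χ x * ‖a x‖) - s * ∫ x, χ x) ≤ totalVariation v U := by
    intro s hs
    set φ : EuclideanSpace ℝ (Fin d) → EuclideanSpace ℝ (Fin d) :=
      fun x => (-χ x) • regularizedDirection s (a x) with hφdef
    have hφ : Continuous φ := hχ.continuous.neg.smul
      ((contDiff_regularizedDirection hs).continuous.comp hsm.continuous)
    have hφc : HasCompactSupport φ :=
      hχc.neg.smul_right (f' := fun x => regularizedDirection s (a x))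
    have hφs : tsupport φ ⊆ tsupport χ := by
      refine closure_mono fun x hx h0 => hx ?_
      simp only [φ]
      rw [show χ x = 0 from h0]
      simp
    have hφ1 : ∀ x, ‖φ x‖ ≤ 1 := by
      intro x
      rw [hφdef, norm_smul, norm_neg, Real.norm_of_nonneg (hχ01 x).1]
      exact mul_le_one₀ (hχ01 x).2 (norm_nonneg _) (norm_regularizedDirection_le hs _)
    have hmem : mollify b φ ∈ testFields U := by
      refine mollify_mem_testFields b hφ hφc hφ1 ?_
      refine (Metric.cthickening_subset_of_subset _ (hφs.trans hχs)).trans ?_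
      refine (Metric.cthickening_cthickening_subset b.rOut_pos.le (sub_pos.2 hδ).le K).trans ?_
      rwa [add_sub_cancel]
    refine le_trans (ENNReal.ofReal_le_ofReal ?_) (ofReal_le_totalVariation hmem)
    rw [integral_mul_divergence_mollify b hv hφ hφc, ← integral_neg, ← integral_const_mul,
      ← integral_sub hint (hχint.const_mul s)]
    have hcont : Continuous fun x => -fderiv ℝ (mollify b v) x (φ x) := by
      have : Continuous fun x => -inner ℝ (a x) (φ x) := (hsm.continuous.inner hφ).neg
      simpa only [ha, inner_gradVec] using this
    refine integral_mono (hint.sub (hχint.const_mul s))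
      (hcont.integrable_of_hasCompactSupport ?_) fun x => ?_
    · refine hφc.mono' fun x hx => subset_tsupport _ fun h0 => hx ?_
      simp [h0]
    · dsimp only
      rw [← inner_gradVec, hφdef, real_inner_smul_right, ← ha, neg_mul, neg_neg]
      have := mul_le_mul_of_nonneg_left (le_inner_regularizedDirection hs (a x)) (hχ01 x).1
      linarith
  have hlim : Tendsto (fun s : ℝ => ENNReal.ofReal ((∫ x, χ x * ‖a x‖) - s * ∫ x, χ x))
      (𝓝[>] 0) (𝓝 (ENNReal.ofReal ((∫ x, χ x * ‖a x‖) - 0 * ∫ x, χ x))) :=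
    (ENNReal.tendsto_ofReal (Continuous.tendsto (by fun_prop) 0)).mono_left nhdsWithin_le_nhds
  have hle := le_of_tendsto hlim
    (by filter_upwards [self_mem_nhdsWithin] with s hs using step s hs)
  rw [zero_mul, sub_zero, ofReal_integral_eq_lintegral_ofReal hint
    (Eventually.of_forall fun x => mul_nonneg (hχ01 x).1 (norm_nonneg _))] at hle
  refine le_trans ?_ hle
  refine le_trans ?_ (setLIntegral_le_lintegral K _)
  refine setLIntegral_mono' hK.measurableSet fun x hx => ?_
  rw [hχ1 x hx, one_mul, ofReal_norm]

/-- Duality and Cauchy–Schwarz with `‖φ‖ ≤ 1`; the converse direction to the preceding estimate. -/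
theorem ofReal_integral_mul_divergence_mollify_le (hv : Integrable v) (hφ : Continuous φ)
    (hφc : HasCompactSupport φ) (hφ1 : ∀ x, ‖φ x‖ ≤ 1) :
    ENNReal.ofReal (∫ x, v x * divergence (mollify b φ) x) ≤
      ∫⁻ x in tsupport φ, ‖gradVec (mollify b v) x‖ₑ := by
  rw [integral_mul_divergence_mollify b hv hφ hφc, ← integral_neg,
    ← setIntegral_eq_integral_of_forall_compl_eq_zero (s := tsupport φ) fun x hx => by
      simp [image_eq_zero_of_notMem_tsupport hx]]
  refine (ENNReal.ofReal_le_ofReal (le_abs_self _)).trans ?_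
  rw [← Real.norm_eq_abs, ofReal_norm]
  refine (enorm_integral_le_lintegral_enorm _).trans (lintegral_mono fun x => ?_)
  rw [enorm_neg, ← inner_gradVec, ← ofReal_norm, ← ofReal_norm]
  refine ENNReal.ofReal_le_ofReal ((norm_inner_le_norm _ _).trans ?_)
  exact mul_le_of_le_one_right (norm_nonneg _) (hφ1 x)

/-- For smooth `φ` the derivative can fall on `φ` instead of the bump. This gives bounds uniform in
the bump and pointwise convergence of divergences as the bumps shrink. -/
theorem fderiv_mollify_eq_mollify (hφ : ContDiff ℝ ∞ φ) (hφc : HasCompactSupport φ)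
    (x k : EuclideanSpace ℝ (Fin d)) :
    fderiv ℝ (mollify b φ) x k = mollify b (fun y => fderiv ℝ φ y k) x := by
  have hb : LocallyIntegrable (b.normed volume) volume := b.integrable_normed.locallyIntegrable
  have h := hφc.hasFDerivAt_convolution_right (ContinuousLinearMap.lsmul ℝ ℝ) hb
    (hφ.of_le (by simp) : ContDiff ℝ 1 φ) x
  have h2 := convolution_precompR_apply (ContinuousLinearMap.lsmul ℝ ℝ) hb (hφc.fderiv (𝕜 := ℝ))
    (hφ.continuous_fderiv (by simp)) x k
  exact (congrArg (fun A => A k) h.fderiv).trans h2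

theorem tendsto_integral_mul_divergence_mollify (hv : Integrable v) (hφ : ContDiff ℝ ∞ φ)
    (hφc : HasCompactSupport φ) :
    Tendsto (fun n => ∫ x, v x * divergence (mollify (bumpSeq d n) φ) x) atTop
      (𝓝 (∫ x, v x * divergence φ x)) := by
  have hcont : ∀ k, Continuous fun y => fderiv ℝ φ y k := fun k =>
    (hφ.continuous_fderiv (by simp)).clm_apply continuous_const
  have hcs : ∀ k, HasCompactSupport fun y => fderiv ℝ φ y k := fun k =>
    hφc.fderiv_apply (𝕜 := ℝ) k
  choose C hC using fun k => (hcont k).bounded_above_of_compact_support (hcs k)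
  have hbound : ∀ n x, ‖divergence (mollify (bumpSeq d n) φ) x‖ ≤
      ∑ i, C (EuclideanSpace.single i 1) := by
    intro n x
    refine (norm_sum_le _ _).trans (Finset.sum_le_sum fun i _ => ?_)
    rw [fderiv_mollify_eq_mollify _ hφ hφc]
    refine (PiLp.norm_apply_le _ i).trans ?_
    have h1 : ‖mollify (bumpSeq d n) (fun y => fderiv ℝ φ y (EuclideanSpace.single i 1)) x‖ₑ ≤ _ :=
      enorm_integral_normed_smul_le (bumpSeq d n)
        (aestronglyMeasurable_comp_sub_left (hcont _).aestronglyMeasurable x)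
    have h2 : ∫⁻ t, ‖fderiv ℝ φ (x - t) (EuclideanSpace.single i 1)‖ₑ
        ∂(bumpMeasure (bumpSeq d n)) ≤
        ∫⁻ t, ENNReal.ofReal (C (EuclideanSpace.single i 1)) ∂(bumpMeasure (bumpSeq d n)) := by
      refine lintegral_mono fun t => ?_
      rw [← ofReal_norm]
      exact ENNReal.ofReal_le_ofReal (hC _ _)
    have h3 := h1.trans h2
    rw [lintegral_const, measure_univ, mul_one, ← ofReal_norm] at h3
    exact (ENNReal.ofReal_le_ofReal_iff ((norm_nonneg _).trans (hC _ 0))).1 h3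
  have hsm : ∀ n, ContDiff ℝ ∞ (mollify (bumpSeq d n) φ) := fun n =>
    contDiff_mollify _ (hφ.continuous.integrable_of_hasCompactSupport hφc).locallyIntegrable
  refine tendsto_integral_of_dominated_convergence
    (fun x => ‖v x‖ * ∑ i, C (EuclideanSpace.single i 1)) (fun n => ?_) (hv.norm.mul_const _)
    (fun n => Eventually.of_forall fun x => ?_) (Eventually.of_forall fun x => ?_)
  · exact hv.aestronglyMeasurable.mul (continuous_divergence (hsm n)).aestronglyMeasurable
  · rw [norm_mul]
    gcongr
    exact hbound n x
  · refine Tendsto.const_mul _ (tendsto_finsetSum _ fun i _ => ?_)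
    simp_rw [fderiv_mollify_eq_mollify _ hφ hφc]
    have h : Tendsto (fun n => mollify (bumpSeq d n)
        (fun y => fderiv ℝ φ y (EuclideanSpace.single i 1)) x) atTop
        (𝓝 (fderiv ℝ φ x (EuclideanSpace.single i 1))) :=
      ContDiffBump.convolution_tendsto_right_of_continuous (tendsto_bumpSeq_rOut d) (hcont _) x
    exact ((EuclideanSpace.proj (𝕜 := ℝ) i).continuous.tendsto _).comp h

end MollifiedFields

/-! ### Energy estimates for functions of bounded variation -/

section BVEnergy

variable {d : ℕ} {m : Measure (EuclideanSpace ℝ (Fin d))} [SFinite m]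
  {v w : EuclideanSpace ℝ (Fin d) → ℝ} {C S U Ω : Set (EuclideanSpace ℝ (Fin d))}
  {e : EuclideanSpace ℝ (Fin d)}

/-- Integrate along segments and translate by `t • h`, which does not leave the `τ`-neighbourhood.
The directional derivative is kept instead of the norm of the gradient, so that averaging over
rotations later gives the sharp constant. -/
theorem lintegral_increment_le_lintegral_gradVec (hw : ContDiff ℝ ∞ w) (hC : MeasurableSet C)
    {τ : ℝ} {h : EuclideanSpace ℝ (Fin d)} (hh : ‖h‖ ≤ τ) :
    ∫⁻ x in C, ‖w (x + h) - w x‖ₑ ≤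
      ∫⁻ y in Metric.cthickening τ C, ‖inner ℝ (gradVec w y) h‖ₑ := by
  have hcg : Continuous (gradVec w) := (contDiff_gradVec hw).continuous
  have hcont : Continuous fun q : EuclideanSpace ℝ (Fin d) × ℝ =>
      ‖inner ℝ (gradVec w (q.1 + q.2 • h)) h‖ₑ := by fun_prop
  calc ∫⁻ x in C, ‖w (x + h) - w x‖ₑ
      ≤ ∫⁻ x in C, ∫⁻ t in Set.Ioc (0 : ℝ) 1, ‖inner ℝ (gradVec w (x + t • h)) h‖ₑ := by
        refine lintegral_mono fun x => ?_
        simpa [inner_gradVec] using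
          enorm_increment_sub_le (hw.of_le (by simp) : ContDiff ℝ 1 w) x h 0
    _ = ∫⁻ t in Set.Ioc (0 : ℝ) 1, ∫⁻ x in C, ‖inner ℝ (gradVec w (x + t • h)) h‖ₑ :=
        lintegral_lintegral_swap hcont.measurable.aemeasurable
    _ ≤ ∫⁻ t in Set.Ioc (0 : ℝ) 1,
          ∫⁻ y in Metric.cthickening τ C, ‖inner ℝ (gradVec w y) h‖ₑ := by
        refine setLIntegral_mono' (measurableSet_Ioc (a := (0 : ℝ)) (b := 1)) fun t ht => ?_
        have hth : ‖t • h‖ ≤ τ := by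
          rw [norm_smul, Real.norm_of_nonneg ht.1.le]
          exact (mul_le_of_le_one_left (norm_nonneg _) ht.2).trans hh
        rw [← lintegral_indicator hC,
          ← lintegral_indicator Metric.isClosed_cthickening.measurableSet,
          ← lintegral_add_right_eq_self ((Metric.cthickening τ C).indicator _) (t • h)]
        refine lintegral_mono fun x => ?_
        by_cases hx : x ∈ C
        swap
        · simp [hx]
        rw [Set.indicator_of_mem hx, Set.indicator_of_mem]
        refine Metric.mem_cthickening_of_dist_le _ x _ _ hx ?_
        rwa [dist_eq_norm, add_sub_cancel_left]
    _ = _ := by simp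

/-- Rotation averaging of the directional derivatives produces `K`. Segments enlarge `C` by `τ` and
mollified fields by `b.rOut`, together less than `δ`. -/
theorem shortEnergy_mollify_le (hm : IsRadialLevy 1 m) (he : ‖e‖ = 1) (hv : Integrable v)
    (hC : IsCompact C) {τ δ : ℝ} (hτ0 : 0 ≤ τ) (hτ : τ ≤ 1)
    (b : ContDiffBump (0 : EuclideanSpace ℝ (Fin d)))
    (hb : b.rOut + τ < δ) (hCU : Metric.cthickening δ C ⊆ U) :
    shortEnergy 1 m τ C (mollify b v) ≤
      ENNReal.ofReal (sphereMean d 1 e) * totalVariation v U := by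
  have hsm : ContDiff ℝ ∞ (mollify b v) := contDiff_mollify b hv.locallyIntegrable
  have hδτ : b.rOut < δ - τ := by linarith
  calc shortEnergy 1 m τ C (mollify b v)
      ≤ ∫⁻ h in Metric.closedBall 0 τ, (∫⁻ y in Metric.cthickening τ C,
          ‖inner ℝ (gradVec (mollify b v) y) h‖ₑ ^ (1 : ℝ)) ∂m := by
        refine setLIntegral_mono' measurableSet_closedBall fun h hh => ?_
        simpa using lintegral_increment_le_lintegral_gradVec hsm hC.measurableSet
          (mem_closedBall_zero_iff.1 hh)
    _ ≤ ENNReal.ofReal (sphereMean d 1 e) * totalVariation v U * 1 := by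
        rw [lintegral_inner_closedBall hm one_pos he (contDiff_gradVec hsm).continuous.measurable]
        gcongr
        · simp_rw [ENNReal.rpow_one]
          refine lintegral_gradVec_mollify_le b hv hC.cthickening hδτ ?_
          refine (Metric.cthickening_cthickening_subset
            (b.rOut_pos.le.trans hδτ.le) hτ0 C).trans ?_
          rwa [sub_add_cancel]
        · exact hm.setLIntegral_closedBall_le_one one_pos hτ
    _ = _ := mul_one _

omit [SFinite m] in
theorem measurable_lintegral_increment (hw : Measurable w) (A : Set (EuclideanSpace ℝ (Fin d))) :
    Measurable fun h => ∫⁻ x in A, ‖w (x + h) - w x‖ₑ ^ (1 : ℝ) := by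
  have h1 : Measurable fun q : EuclideanSpace ℝ (Fin d) × EuclideanSpace ℝ (Fin d) =>
      ‖w (q.2 + q.1) - w q.2‖ₑ ^ (1 : ℝ) :=
    ((hw.comp (measurable_snd.add measurable_fst)).sub (hw.comp measurable_snd)).enorm.pow_const 1
  exact h1.lintegral_prod_right'

omit [SFinite m] in
theorem lintegral_increment_le_liminf (hv : Integrable v) (A : Set (EuclideanSpace ℝ (Fin d)))
    (h : EuclideanSpace ℝ (Fin d)) :
    ∫⁻ x in A, ‖v (x + h) - v x‖ₑ ^ (1 : ℝ) ≤ liminf (fun n => ∫⁻ x in A,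
      ‖mollify (bumpSeq d n) v (x + h) - mollify (bumpSeq d n) v x‖ₑ ^ (1 : ℝ)) atTop := by
  have hae := ae_tendsto_mollify_bumpSeq hv.locallyIntegrable
  have hae' : ∀ᵐ x, Tendsto (fun n => mollify (bumpSeq d n) v (x + h)) atTop (𝓝 (v (x + h))) :=
    (measurePreserving_add_right volume h).quasiMeasurePreserving.ae hae
  have hlim : ∀ᵐ x ∂(volume.restrict A), liminf
      (fun n => ‖mollify (bumpSeq d n) v (x + h) - mollify (bumpSeq d n) v x‖ₑ ^ (1 : ℝ)) atTop =
      ‖v (x + h) - v x‖ₑ ^ (1 : ℝ) := by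
    refine ae_restrict_of_ae ?_
    filter_upwards [hae, hae'] with x h1 h2
    exact ((h2.sub h1).enorm.ennrpow_const 1).liminf_eq
  rw [← lintegral_congr_ae hlim]
  refine lintegral_liminf_le fun n => ?_
  have hc : Continuous (mollify (bumpSeq d n) v) :=
    (contDiff_mollify _ hv.locallyIntegrable).continuous
  exact (ENNReal.continuous_rpow_const.comp (Continuous.enorm (by fun_prop))).measurable

/-- The bound for mollifications does not depend on the bump, so it survives two applications of
Fatou, first in `x` and then in `h`. -/
theorem shortEnergy_le_totalVariation (hm : IsRadialLevy 1 m) (he : ‖e‖ = 1)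
    (hv : Integrable v) (hC : IsCompact C) {τ δ : ℝ} (hτ0 : 0 ≤ τ) (hτ : τ ≤ 1) (hτδ : τ < δ)
    (hCU : Metric.cthickening δ C ⊆ U) :
    shortEnergy 1 m τ C v ≤ ENNReal.ofReal (sphereMean d 1 e) * totalVariation v U := by
  have hbound : ∀ᶠ n in atTop, shortEnergy 1 m τ C (mollify (bumpSeq d n) v) ≤
      ENNReal.ofReal (sphereMean d 1 e) * totalVariation v U := by
    filter_upwards [(tendsto_bumpSeq_rOut d).eventually_lt_const (sub_pos.2 hτδ)] with n hn
    exact shortEnergy_mollify_le hm he hv hC hτ0 hτ _ (by linarith) hCU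
  refine le_trans ?_ (liminf_le_of_frequently_le' hbound.frequently)
  refine (lintegral_mono fun h => lintegral_increment_le_liminf hv C h).trans ?_
  exact lintegral_liminf_le fun n => measurable_lintegral_increment
    (contDiff_mollify _ hv.locallyIntegrable).continuous.measurable C

omit [SFinite m] in
-- Averaging over translates of length below `b.rOut` cannot increase the energy, provided the set
-- is enlarged to contain the translates.
theorem shortEnergy_mollify_le_shortEnergy (hvm : StronglyMeasurable v) (hv : Integrable v)
    (hS : MeasurableSet S)
    (b : ContDiffBump (0 : EuclideanSpace ℝ (Fin d))) (τ : ℝ) :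
    shortEnergy 1 m τ S (mollify b v) ≤ shortEnergy 1 m τ (Metric.cthickening b.rOut S) v := by
  refine lintegral_mono fun h => ?_
  refine (lintegral_enorm_mollify_increment_rpow_le le_rfl b hvm hv.locallyIntegrable S h).trans ?_
  calc ∫⁻ t, (∫⁻ x in S, ‖v (x + h - t) - v (x - t)‖ₑ ^ (1 : ℝ)) ∂(bumpMeasure b)
      ≤ ∫⁻ t, (∫⁻ x in Metric.cthickening b.rOut S, ‖v (x + h) - v x‖ₑ ^ (1 : ℝ))
          ∂(bumpMeasure b) := by
        refine lintegral_mono_ae ?_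
        filter_upwards [ae_bumpMeasure_norm_lt b] with t ht
        rw [← lintegral_indicator hS,
          ← lintegral_indicator Metric.isClosed_cthickening.measurableSet,
          ← lintegral_sub_right_eq_self ((Metric.cthickening b.rOut S).indicator _) t]
        refine lintegral_mono fun x => ?_
        by_cases hx : x ∈ S
        swap
        · simp [hx]
        rw [Set.indicator_of_mem hx, Set.indicator_of_mem, sub_add_eq_add_sub]
        refine Metric.mem_cthickening_of_dist_le _ x _ _ hx ?_
        simpa [dist_eq_norm] using ht.le
    _ = _ := by simp

/-- On the compact 1-neighbourhood of `S` the gradient is uniformly continuous, so the remainder is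
pointwise at most `σ‖h‖`; choose `σ` with `σ |S| ≤ η`. -/
theorem exists_remainder_le (hw : ContDiff ℝ ∞ w) (hS : IsCompact S) {η : ℝ≥0∞} (hη : 0 < η) :
    ∃ τ > 0, ∀ h : EuclideanSpace ℝ (Fin d), ‖h‖ ≤ τ →
      ∫⁻ x in S, ‖w (x + h) - w x - inner ℝ (gradVec w x) h‖ₑ ^ (1 : ℝ) ≤
        η * ‖h‖ₑ ^ (1 : ℝ) := by
  have hcg : Continuous (gradVec w) := (contDiff_gradVec hw).continuous
  obtain ⟨σ, hσ, hση⟩ : ∃ σ : ℝ, 0 < σ ∧ ENNReal.ofReal σ * volume S ≤ η := by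
    have hlim : Tendsto (fun σ : ℝ => ENNReal.ofReal σ * volume S) (𝓝[>] 0) (𝓝 0) := by
      have h1 : Tendsto ENNReal.ofReal (𝓝[>] 0) (𝓝 (ENNReal.ofReal 0)) :=
        (ENNReal.tendsto_ofReal tendsto_id).mono_left nhdsWithin_le_nhds
      have h2 := ENNReal.Tendsto.mul_const (b := volume S) h1 (Or.inr hS.measure_lt_top.ne)
      simpa using h2
    obtain ⟨σ, h1, h2⟩ := ((hlim.eventually_lt_const hη).and self_mem_nhdsWithin).exists
    exact ⟨σ, h2, h1.le⟩
  have huc := (hS.cthickening (r := 1)).uniformContinuousOn_of_continuous hcg.continuousOn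
  rw [Metric.uniformContinuousOn_iff_le] at huc
  obtain ⟨τ₀, hτ₀, huc⟩ := huc σ hσ
  refine ⟨min τ₀ 1, by positivity, fun h hh => ?_⟩
  have hpt : ∀ x ∈ S, ‖w (x + h) - w x - inner ℝ (gradVec w x) h‖ₑ ^ (1 : ℝ) ≤
      ENNReal.ofReal σ * ‖h‖ₑ := by
    intro x hx
    rw [ENNReal.rpow_one]
    refine (enorm_increment_sub_le (hw.of_le (by simp) : ContDiff ℝ 1 w) x h _).trans ?_
    calc ∫⁻ t in Set.Ioc (0 : ℝ) 1, ‖fderiv ℝ w (x + t • h) h - inner ℝ (gradVec w x) h‖ₑ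
        ≤ ∫⁻ t in Set.Ioc (0 : ℝ) 1, ENNReal.ofReal σ * ‖h‖ₑ := by
          refine setLIntegral_mono' (measurableSet_Ioc (a := (0 : ℝ)) (b := 1)) fun t ht => ?_
          have hth : ‖t • h‖ ≤ min τ₀ 1 := by
            rw [norm_smul, Real.norm_of_nonneg ht.1.le]
            exact (mul_le_of_le_one_left (norm_nonneg _) ht.2).trans hh
          have hd : dist (x + t • h) x = ‖t • h‖ := by
            rw [dist_eq_norm, add_sub_cancel_left]
          have h1 := huc (x + t • h)
            (Metric.mem_cthickening_of_dist_le _ x _ _ hx (hd.trans_le (hth.trans (min_le_right _ _))))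
            x (Metric.self_subset_cthickening S hx) (hd.trans_le (hth.trans (min_le_left _ _)))
          rw [← inner_gradVec, ← inner_sub_left, ← ofReal_norm, ← ofReal_norm,
            ← ENNReal.ofReal_mul hσ.le]
          refine ENNReal.ofReal_le_ofReal ((norm_inner_le_norm _ _).trans ?_)
          gcongr
          rwa [← dist_eq_norm]
      _ = _ := by simp
  calc ∫⁻ x in S, ‖w (x + h) - w x - inner ℝ (gradVec w x) h‖ₑ ^ (1 : ℝ)
      ≤ ∫⁻ x in S, ENNReal.ofReal σ * ‖h‖ₑ := setLIntegral_mono' hS.measurableSet hpt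
    _ = ENNReal.ofReal σ * volume S * ‖h‖ₑ := by rw [setLIntegral_const]; ring
    _ ≤ _ := by rw [ENNReal.rpow_one]; gcongr

end BVEnergy

/-! ### The limit for functions of bounded variation -/

section BVLimit

variable {d : ℕ} {ν : ℝ → EuclideanSpace ℝ (Fin d) → ℝ≥0∞} {e : EuclideanSpace ℝ (Fin d)}
  {Ω U E S : Set (EuclideanSpace ℝ (Fin d))} {u v : EuclideanSpace ℝ (Fin d) → ℝ}

theorem nonlocalMeasure_le_totalVariation (hν : IsDiracApprox d 1 ν) (he : ‖e‖ = 1)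
    (hΩ : IsOpen Ω) (hE : IsCompact E) (hEΩ : E ⊆ Ω) (huv : u =ᵐ[volume.restrict Ω] v)
    (hvm : StronglyMeasurable v) (hv : Integrable v) {τ δ : ℝ} (hτ0 : 0 ≤ τ) (hτ : τ ≤ 1)
    (hτδ : τ < δ) (hEU : Metric.cthickening δ E ⊆ U) {ε : ℝ} (hε : 0 < ε) :
    nonlocalMeasure 1 Ω (ν ε) u E ≤ ENNReal.ofReal (sphereMean d 1 e) * totalVariation v U +
      2 * (∫⁻ x, ‖v x‖ₑ) * volume.withDensity (ν ε) {h | τ < ‖h‖} := by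
  rw [nonlocalMeasure_apply (hν.measurable ε hε) (fun h => hν.radial ε hε _ _ (norm_neg h))
    hΩ.measurableSet hE.measurableSet hEΩ hvm.measurable huv]
  refine (nonlocalEnergy_le le_rfl hvm.measurable τ).trans (add_le_add ?_ (by simp))
  exact shortEnergy_le_totalVariation (hν.isRadialLevy hε) he hv hE hτ0 hτ hτδ hEU

/-- For a fixed bump the mollified function is smooth, so the Taylor lower bound applies to it. Its
energy on `S` is in turn at most that of `v` on a slightly larger set still inside `U`. -/
theorem lintegral_gradVec_mollify_le_liminf (hν : IsDiracApprox d 1 ν) (he : ‖e‖ = 1)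
    (hΩ : IsOpen Ω) (hU : IsOpen U) (hUΩ : U ⊆ Ω) (huv : u =ᵐ[volume.restrict Ω] v)
    (hvm : StronglyMeasurable v) (hv : Integrable v) (hS : IsCompact S) {δ : ℝ}
    (hSU : Metric.cthickening δ S ⊆ U) (b : ContDiffBump (0 : EuclideanSpace ℝ (Fin d)))
    (hb : b.rOut < δ) :
    ENNReal.ofReal (sphereMean d 1 e) * ∫⁻ x in S, ‖gradVec (mollify b v) x‖ₑ ≤
      liminf (fun ε => nonlocalMeasure 1 Ω (ν ε) u U) (𝓝[>] 0) := by
  have hsm : ContDiff ℝ ∞ (mollify b v) := contDiff_mollify b hv.locallyIntegrable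
  refine ENNReal.le_of_forall_pos_le_add fun η hη _ => ?_
  obtain ⟨τ₀, hτ₀, hrem⟩ := exists_remainder_le hsm hS (η := η) (by simpa using hη)
  set τ := min (min τ₀ (δ - b.rOut)) 1 with hτdef
  have hδb : 0 < δ - b.rOut := sub_pos.2 hb
  have hτ : 0 < τ := by positivity
  have hττ₀ : τ ≤ τ₀ := (min_le_left _ _).trans (min_le_left _ _)
  have hτδ : τ ≤ δ - b.rOut := (min_le_left _ _).trans (min_le_right _ _)
  have hbound := le_liminf_of_mul_le (θ := 1) (c := η)
    (f := fun ε => nonlocalMeasure 1 Ω (ν ε) u U)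
    (M := ENNReal.ofReal (sphereMean d 1 e) * ∫⁻ x in S, ‖gradVec (mollify b v) x‖ₑ)
    (hν.tendsto_setLIntegral_closedBall one_pos hτ (min_le_right _ _)) ENNReal.one_ne_top ?_
  · simpa using hbound
  filter_upwards [self_mem_nhdsWithin] with ε hε
  have hm := hν.isRadialLevy hε
  -- For exponent 1 the splitting is trivial, with both constants equal to 1.
  have h1 := le_shortEnergy_of_remainder (A := S) hm one_pos he hsm.continuous.measurable
    (contDiff_gradVec hsm).continuous.measurable (τ := τ) (min_le_right _ _) (η := η) (θ := 1)
    (C := 1) (fun a b => by simp) fun h hh => hrem h (hh.trans hττ₀)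
  simp_rw [ENNReal.rpow_one ‖gradVec (mollify b v) _‖ₑ] at h1
  refine h1.trans ?_
  rw [one_mul, one_mul, one_mul]
  gcongr
  rw [nonlocalMeasure_apply (hν.measurable ε hε) (fun h => hν.radial ε hε _ _ (norm_neg h))
    hΩ.measurableSet hU.measurableSet hUΩ hvm.measurable huv]
  have hsub : Metric.cthickening b.rOut S ⊆ U :=
    (Metric.cthickening_mono hb.le S).trans hSU
  refine (shortEnergy_mollify_le_shortEnergy hvm hv hS.measurableSet b τ).trans ?_
  refine (shortEnergy_le_nonlocalEnergy (Ω := Ω) hvm.measurable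
    Metric.isClosed_cthickening.measurableSet fun x hx h hh => ?_).trans
    (lintegral_mono_set hsub)
  refine hUΩ (hSU ?_)
  have h2 : x + h ∈ Metric.cthickening (δ - b.rOut) (Metric.cthickening b.rOut S) := by
    refine Metric.mem_cthickening_of_dist_le _ x _ _ hx ?_
    rw [dist_eq_norm, add_sub_cancel_left]
    exact hh.trans hτδ
  have h3 := Metric.cthickening_cthickening_subset hδb.le b.rOut_pos.le S h2
  rwa [sub_add_cancel] at h3

/-- The limit `ε → 0` is taken first, at a fixed bump; only then do the bumps shrink, with the
mollified test fields recovering the pairing with `φ`. -/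
theorem totalVariation_le_liminf (hν : IsDiracApprox d 1 ν) (he : ‖e‖ = 1)
    (hΩ : IsOpen Ω) (hU : IsOpen U) (hUΩ : U ⊆ Ω) (huv : u =ᵐ[volume.restrict Ω] v)
    (hvm : StronglyMeasurable v) (hv : Integrable v) :
    ENNReal.ofReal (sphereMean d 1 e) * totalVariation v U ≤
      liminf (fun ε => nonlocalMeasure 1 Ω (ν ε) u U) (𝓝[>] 0) := by
  unfold totalVariation
  simp_rw [ENNReal.mul_iSup]
  refine iSup₂_le fun φ hφ => ?_
  obtain ⟨δ, hδ, hSU⟩ := hφ.2.1.isCompact.exists_cthickening_subset_open hU hφ.2.2.1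
  have hlim : Tendsto (fun n => ENNReal.ofReal (sphereMean d 1 e) *
      ENNReal.ofReal (∫ x, v x * divergence (mollify (bumpSeq d n) φ) x)) atTop
      (𝓝 (ENNReal.ofReal (sphereMean d 1 e) * ENNReal.ofReal (∫ x, v x * divergence φ x))) :=
    ENNReal.Tendsto.const_mul (ENNReal.tendsto_ofReal
      (tendsto_integral_mul_divergence_mollify hv hφ.1 hφ.2.1)) (Or.inr ENNReal.ofReal_ne_top)
  refine le_of_tendsto hlim ?_
  filter_upwards [(tendsto_bumpSeq_rOut d).eventually_lt_const hδ] with n hn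
  refine le_trans ?_ (lintegral_gradVec_mollify_le_liminf hν he hΩ hU hUΩ huv hvm hv
    hφ.2.1.isCompact hSU (bumpSeq d n) hn)
  gcongr
  exact ofReal_integral_mul_divergence_mollify_le _ hv hφ.1.continuous hφ.2.1 hφ.2.2.2

theorem nonlocalMeasure_bv (hν : IsDiracApprox d 1 ν) (he : ‖e‖ = 1) (hΩ : IsOpen Ω)
    (hu : IsBV Ω u) :
    (∀ ε : ℝ, 0 < ε → IsRadonOn Ω (nonlocalMeasure 1 Ω (ν ε) u)) ∧
    (∃! Λ : Measure (EuclideanSpace ℝ (Fin d)), IsVariationMeasure Ω u Λ) ∧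
    ∀ Λ : Measure (EuclideanSpace ℝ (Fin d)), IsVariationMeasure Ω u Λ →
      IsRadonOn Ω (ENNReal.ofReal (sphereMean d 1 e) • Λ) ∧
      ConvergesWeaklyOn Ω (fun ε => nonlocalMeasure 1 Ω (ν ε) u)
        (ENNReal.ofReal (sphereMean d 1 e) • Λ) ∧
      ∀ E : Set (EuclideanSpace ℝ (Fin d)), IsCompact E → E ⊆ Ω → Λ (frontier E) = 0 →
        Tendsto (fun ε : ℝ => nonlocalMeasure 1 Ω (ν ε) u E) (𝓝[>] 0)
          (𝓝 ((ENNReal.ofReal (sphereMean d 1 e) • Λ) E)) := by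
  obtain ⟨v, hvm, huv, hv1, -⟩ := exists_global_representative hΩ.measurableSet hu.1
  have hv : Integrable v := memLp_one_iff_integrable.1 hv1
  have hTV : totalVariation v Ω < ⊤ := by
    rw [← bvVariation_eq_totalVariation huv subset_rfl]; exact hu.2
  set c := ENNReal.ofReal (sphereMean d 1 e) with hc
  have hct : c ≠ ⊤ := ENNReal.ofReal_ne_top
  have hconst : 2 * (∫⁻ x, ‖v x‖ₑ) ≠ ⊤ := ENNReal.mul_ne_top (by simp) hv.2.ne
  have hfin : ∀ ε : ℝ, 0 < ε → ∀ E, IsCompact E → E ⊆ Ω →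
      nonlocalMeasure 1 Ω (ν ε) u E < ⊤ := by
    intro ε hε E hE hEΩ
    obtain ⟨δ, hδ, hEδ⟩ := hE.exists_cthickening_subset_open hΩ hEΩ
    have hτ : 0 < min (δ / 2) 1 := by positivity
    refine (nonlocalMeasure_le_totalVariation hν he hΩ hE hEΩ huv hvm hv hτ.le
      (min_le_right _ _) ((min_le_left _ _).trans_lt (half_lt_self hδ)) hEδ hε).trans_lt ?_
    refine ENNReal.add_lt_top.2 ⟨ENNReal.mul_lt_top hct.lt_top hTV, ?_⟩
    exact ENNReal.mul_lt_top hconst.lt_top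
      ((hν.isRadialLevy hε).measure_norm_gt_ne_top one_pos hτ).lt_top
  refine ⟨fun ε hε => ⟨nonlocalMeasure_compl hΩ.measurableSet _, hfin ε hε⟩, ?_, ?_⟩
  · obtain ⟨Λ, hΛ⟩ := exists_isVariationMeasure hv hΩ huv
    exact ⟨Λ, hΛ, fun Λ' h' => h'.unique hΛ hΩ hu.2⟩
  intro Λ hΛ
  have hΛfin := hΛ.isFiniteMeasure hΩ hu.2
  have hΛU : ∀ U, IsOpen U → U ⊆ Ω → Λ U = totalVariation v U := fun U hU hUΩ => by
    rw [hΛ.2 U hU hUΩ, bvVariation_eq_totalVariation huv hUΩ]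
  -- Take the open `ρ`-thickening of `E` as the neighbourhood in the energy bound and let `ρ → 0`;
  -- the finite measure `Λ` is continuous along closed thickenings of a compact set.
  have hup : ∀ E, IsCompact E → E ⊆ Ω →
      limsup (fun ε => nonlocalMeasure 1 Ω (ν ε) u E) (𝓝[>] 0) ≤ (c • Λ) E := by
    intro E hE hEΩ
    obtain ⟨δ, hδ, hEδ⟩ := hE.exists_cthickening_subset_open hΩ hEΩ
    have hlim : Tendsto (fun ρ => c * Λ (Metric.cthickening ρ E)) (𝓝[>] 0) (𝓝 (c * Λ E)) :=
      ENNReal.Tendsto.const_mul ((tendsto_measure_cthickening_of_isCompact hE).mono_left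
        nhdsWithin_le_nhds) (Or.inr hct)
    refine ge_of_tendsto hlim ?_
    filter_upwards [Ioo_mem_nhdsGT hδ] with ρ hρ
    have hρ0 : 0 < ρ := hρ.1
    have hτ : 0 < min (ρ / 4) 1 := by positivity
    have hsub : Metric.cthickening (ρ / 2) E ⊆ Metric.thickening ρ E :=
      Metric.cthickening_subset_thickening' hρ0 (half_lt_self hρ0) E
    have hsubΩ : Metric.thickening ρ E ⊆ Ω :=
      (Metric.thickening_subset_cthickening_of_le hρ.2.le E).trans hEδ
    have hT := ENNReal.Tendsto.const_mul (hν.tendsto_measure_norm_gt one_pos hτ) (Or.inr hconst)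
    rw [mul_zero] at hT
    refine limsup_le_of_le_add hT ?_
    filter_upwards [self_mem_nhdsWithin] with ε hε
    refine (nonlocalMeasure_le_totalVariation hν he hΩ hE hEΩ huv hvm hv hτ.le
      (min_le_right _ _) ((min_le_left _ _).trans_lt (by linarith)) hsub hε).trans ?_
    rw [← hΛU _ Metric.isOpen_thickening hsubΩ]
    gcongr
    exact Metric.thickening_subset_cthickening ρ E
  -- The lower bound holds on open sets, so it is applied to the interior; the null frontier makes
  -- up for the difference.
  have hlow : ∀ E, IsCompact E → E ⊆ Ω → (c • Λ) (frontier E) = 0 →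
      (c • Λ) E ≤ liminf (fun ε => nonlocalMeasure 1 Ω (ν ε) u E) (𝓝[>] 0) := by
    intro E hE hEΩ hfr
    have hsub : E ⊆ interior E ∪ frontier E := by
      rw [← closure_eq_interior_union_frontier]; exact subset_closure
    have hintΩ : interior E ⊆ Ω := interior_subset.trans hEΩ
    calc (c • Λ) E ≤ (c • Λ) (interior E) + (c • Λ) (frontier E) :=
          (measure_mono hsub).trans (measure_union_le _ _)
      _ = c * totalVariation v (interior E) := by
          rw [hfr, add_zero, Measure.smul_apply, smul_eq_mul, hΛU _ isOpen_interior hintΩ]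
      _ ≤ liminf (fun ε => nonlocalMeasure 1 Ω (ν ε) u (interior E)) (𝓝[>] 0) :=
          totalVariation_le_liminf hν he hΩ isOpen_interior hintΩ huv hvm hv
      _ ≤ _ := liminf_le_liminf (Eventually.of_forall fun ε => measure_mono interior_subset)
  have hcΛ : ∀ E, IsCompact E → E ⊆ Ω → (c • Λ) E < ⊤ := fun E _ _ =>
    ENNReal.mul_lt_top hct.lt_top (measure_lt_top Λ E)
  refine ⟨⟨by simp [hΛ.1], hcΛ⟩, ?_, fun E hE hEΩ hfr =>
    tendsto_of_limsup_le_of_le_liminf (hup E hE hEΩ) (hlow E hE hEΩ (by simp [hfr]))⟩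
  exact convergesWeaklyOn_of_tendsto_compact hfin hcΛ
    (fun K hK hKΩ => eventually_le_of_tendsto (hcΛ K hK hKΩ).ne (hup K hK hKΩ))
    fun K hK hKΩ hfr => tendsto_of_limsup_le_of_le_liminf (hup K hK hKΩ) (hlow K hK hKΩ hfr)

end BVLimit

end NonlocalBV

theorem theorem1p6 (d : ℕ) (p : ℝ) (hp : 1 ≤ p)
    (ν : ℝ → EuclideanSpace ℝ (Fin d) → ℝ≥0∞) (hν : NonlocalBV.IsDiracApprox d p ν)
    (e : EuclideanSpace ℝ (Fin d)) (he : ‖e‖ = 1)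
    (Ω : Set (EuclideanSpace ℝ (Fin d))) (hΩ : IsOpen Ω)
    (u : EuclideanSpace ℝ (Fin d) → ℝ) :
    (∀ g : EuclideanSpace ℝ (Fin d) → EuclideanSpace ℝ (Fin d),
      NonlocalBV.IsSobolevWithGradient p Ω u g →
        (∀ ε : ℝ, 0 < ε → NonlocalBV.IsRadonOn Ω (NonlocalBV.nonlocalMeasure p Ω (ν ε) u)) ∧
        NonlocalBV.IsRadonOn Ω
          (NonlocalBV.gradientMeasure (NonlocalBV.sphereMean d p e) p Ω g) ∧
        NonlocalBV.ConvergesWeaklyOn Ω (fun ε => NonlocalBV.nonlocalMeasure p Ω (ν ε) u)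
          (NonlocalBV.gradientMeasure (NonlocalBV.sphereMean d p e) p Ω g) ∧
        ∀ E : Set (EuclideanSpace ℝ (Fin d)), IsCompact E → E ⊆ Ω →
          Tendsto (fun ε : ℝ => NonlocalBV.nonlocalMeasure p Ω (ν ε) u E) (𝓝[>] 0)
            (𝓝 (NonlocalBV.gradientMeasure (NonlocalBV.sphereMean d p e) p Ω g E))) ∧
    (p = 1 → NonlocalBV.IsBV Ω u →
      (∀ ε : ℝ, 0 < ε → NonlocalBV.IsRadonOn Ω (NonlocalBV.nonlocalMeasure p Ω (ν ε) u)) ∧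
      (∃! Λ : Measure (EuclideanSpace ℝ (Fin d)), NonlocalBV.IsVariationMeasure Ω u Λ) ∧
      ∀ Λ : Measure (EuclideanSpace ℝ (Fin d)), NonlocalBV.IsVariationMeasure Ω u Λ →
        NonlocalBV.IsRadonOn Ω (ENNReal.ofReal (NonlocalBV.sphereMean d p e) • Λ) ∧
        NonlocalBV.ConvergesWeaklyOn Ω (fun ε => NonlocalBV.nonlocalMeasure p Ω (ν ε) u)
          (ENNReal.ofReal (NonlocalBV.sphereMean d p e) • Λ) ∧
        ∀ E : Set (EuclideanSpace ℝ (Fin d)), IsCompact E → E ⊆ Ω → Λ (frontier E) = 0 →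
          Tendsto (fun ε : ℝ => NonlocalBV.nonlocalMeasure p Ω (ν ε) u E) (𝓝[>] 0)
            (𝓝 ((ENNReal.ofReal (NonlocalBV.sphereMean d p e) • Λ) E))) := by
  refine ⟨fun g hg => NonlocalBV.nonlocalMeasure_sobolev hp hν he hΩ hg, fun hp1 hu => ?_⟩
  subst hp1
  exact NonlocalBV.nonlocalMeasure_bv hν he hΩ hu
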